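/- Let $\mathbb H=\{(z_1,z_2)\in\mathbb C^2: |z_1|<|z_2|<1\}$ be the Hartogs triangle, $\mathbb D$ the open unit disc, $\mathbb D^*=\mathbb D\setminus\{0\}$, and let $\phi:\mathbb H\to\mathbb D\times\mathbb D^*$, $\phi(z_1,z_2)=(z_1/z_2,z_2)$. For a $(0,1)$-form $\alpha=\alpha_1\,d\bar z_1+\alpha_2\,d\bar z_2$ with locally integrable coefficients on $\mathbb H$ put $\tilde\alpha_j=\alpha_j\circ\phi^{-1}$ and let $$f=f_1\,d\bar w_1+f_2\,d\bar w_2,\qquad f_1=\bar w_2\,\tilde\alpha_1,\quad f_2=\bar w_1\,\tilde\alpha_1+\tilde\alpha_2,$$ be the corresponding form on $\mathbb D\times\mathbb D^*$. Let $\mathscr D f=\tfrac12\left(\frac{\partial f_1}{\partial\bar w_2}+\frac{\partial f_2}{\partial\bar w_1}\right)$ in the sense of distributions and, whenever $\mathscr D f$ is a locally integrable function, let $$\begin{aligned}T(f)(w)={}&\frac{-1}{2\pi i}\int_{\mathbb D^*}\frac{f_2(w_1,\zeta_2)}{\zeta_2-w_2}\,d\bar\zeta_2\wedge d\zeta_2+\frac{-1}{2\pi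 i}\int_{\mathbb D}\frac{f_1(\zeta_1,w_2)}{\zeta_1-w_1}\,d\bar\zeta_1\wedge d\zeta_1\\&+\frac{-1}{(2\pi i)^2}\int_{\mathbb D\times\mathbb D^*}\frac{\mathscr D f(\zeta_1,\zeta_2)}{(\zeta_1-w_1)(\zeta_2-w_2)}\,d\bar\zeta_1\wedge d\zeta_1\wedge d\bar\zeta_2\wedge d\zeta_2 .\end{aligned}$$ **Theorem.** Let $1\le p<\infty$. There is a constant $C>0$ such that the following holds for every $(0,1)$-form $\alpha$ on $\mathbb H$ that is $\bar\partial$-closed in the weak sense (that is, $\partial\alpha_2/\partial\bar z_1=\partial\alpha_1/\partial\bar z_2$ as distributions on $\mathbb H$), satisfies $\bar z_1\alpha_1+\bar z_2\alpha_2=0$ almost everywhere on $\mathbb H$, and has $\alpha_1\in L^p(\mathbb H)$ (with respect to Lebesgue measure, without weight). The function $T(f)$ is well defined ($\mathscr D f$ is a locally integrable function, and the integrals converge absolutely for almost every $w\in\mathbb D\times\mathbb D^*$), and $v=T(f)\circ\phi$ belongs to $L^p(\mathbb H)$, is a weak solution of $\bar\partial v=\alpha$ on $\mathbb H$, and satisfies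 $$\|v\|_{L^p(\mathbb H)}\le C\,\|\alpha_1\|_{L^p(\mathbb H)} .$$ -/

import Mathlib

open MeasureTheory
open scoped NNReal ENNReal ComplexConjugate

noncomputable section

namespace HartogsDbar

/-- The Hartogs triangle `{(z₁, z₂) : |z₁| < |z₂| < 1}` in `ℂ²`. -/
def hartogs : Set (ℂ × ℂ) := {z | ‖z.1‖ < ‖z.2‖ ∧ ‖z.2‖ < 1}

/-- The open unit disc. -/
def disc : Set ℂ := {z | ‖z‖ < 1}

/-- The punctured unit disc. -/
def puncturedDisc : Set ℂ := {z | 0 < ‖z‖ ∧ ‖z‖ < 1}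

/-- The map `φ(z₁, z₂) = (z₁ / z₂, z₂)`, a biholomorphism from the Hartogs triangle onto the
product of the disc and the punctured disc. -/
def phi (z : ℂ × ℂ) : ℂ × ℂ := (z.1 / z.2, z.2)

/-- The inverse `φ⁻¹(w₁, w₂) = (w₁ w₂, w₂)`. -/
def phiInv (w : ℂ × ℂ) : ℂ × ℂ := (w.1 * w.2, w.2)

/-- A `(0,1)`-form `c₁ dz̄₁ + c₂ dz̄₂`, given by its coefficient functions. -/
structure Form01 where
  c₁ : ℂ × ℂ → ℂ
  c₂ : ℂ × ℂ → ℂ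

/-- `∂ψ/∂z̄₁ = (∂ψ/∂x₁ + i ∂ψ/∂y₁) / 2`. -/
def dbar₁ (ψ : ℂ × ℂ → ℂ) (z : ℂ × ℂ) : ℂ :=
  (1 / 2) * (fderiv ℝ ψ z (1, 0) + Complex.I * fderiv ℝ ψ z (Complex.I, 0))

/-- `∂ψ/∂z̄₂ = (∂ψ/∂x₂ + i ∂ψ/∂y₂) / 2`. -/
def dbar₂ (ψ : ℂ × ℂ → ℂ) (z : ℂ × ℂ) : ℂ :=
  (1 / 2) * (fderiv ℝ ψ z (0, 1) + Complex.I * fderiv ℝ ψ z (0, Complex.I))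

/-- Test functions: `ψ ∈ C_c^∞(U)`. -/
def IsTest (U : Set (ℂ × ℂ)) (ψ : ℂ × ℂ → ℂ) : Prop :=
  ContDiff ℝ ((⊤ : ℕ∞) : WithTop ℕ∞) ψ ∧ HasCompactSupport ψ ∧ tsupport ψ ⊆ U

/-- The coefficients are locally integrable on `U`, so that they are distributions there. -/
def Form01.LocInt (f : Form01) (U : Set (ℂ × ℂ)) : Prop :=
  LocallyIntegrableOn f.c₁ U volume ∧ LocallyIntegrableOn f.c₂ U volume

/-- `∂̄f = 0` on `U` in the weak sense: `∂f₂/∂z̄₁ = ∂f₁/∂z̄₂` as distributions. -/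
def Form01.WeaklyClosed (f : Form01) (U : Set (ℂ × ℂ)) : Prop :=
  f.LocInt U ∧ ∀ ψ, IsTest U ψ →
    ∫ z in U, f.c₂ z * dbar₁ ψ z = ∫ z in U, f.c₁ z * dbar₂ ψ z

/-- `v` is a weak solution of `∂̄v = f` on `U`. -/
def IsWeakSolution (U : Set (ℂ × ℂ)) (v : ℂ × ℂ → ℂ) (f : Form01) : Prop :=
  LocallyIntegrableOn v U volume ∧ f.LocInt U ∧ ∀ ψ, IsTest U ψ →
    (∫ z in U, v z * dbar₁ ψ z = -∫ z in U, f.c₁ z * ψ z) ∧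
    (∫ z in U, v z * dbar₂ ψ z = -∫ z in U, f.c₂ z * ψ z)

/-- The locally integrable function `g` represents, on `U`, the distribution
`𝒟 f = (∂f₁/∂z̄₂ + ∂f₂/∂z̄₁) / 2`. -/
def IsScrD (U : Set (ℂ × ℂ)) (f : Form01) (g : ℂ × ℂ → ℂ) : Prop :=
  f.LocInt U ∧ LocallyIntegrableOn g U volume ∧ ∀ ψ, IsTest U ψ →
    ∫ z in U, g z * ψ z =
      -((1 / 2) * ((∫ z in U, f.c₁ z * dbar₂ ψ z) + ∫ z in U, f.c₂ z * dbar₁ ψ z))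

open Classical in
/-- The function `𝒟 f` on `U` (determined up to null sets in `U`), whenever the distribution
`𝒟 f` is represented by a locally integrable function. -/
def scrD (U : Set (ℂ × ℂ)) (f : Form01) : ℂ × ℂ → ℂ :=
  if h : ∃ g, IsScrD U f g then h.choose else 0

/-- `∫_D g dζ̄ ∧ dζ`; here `dζ̄ ∧ dζ = 2i dA` with `dA` the Lebesgue measure of `ℂ`. -/
def cIntegral (D : Set ℂ) (g : ℂ → ℂ) : ℂ := 2 * Complex.I * ∫ ζ in D, g ζ

/-- `∫_U g dζ̄₁ ∧ dζ₁ ∧ dζ̄₂ ∧ dζ₂`; this volume form is `(2i)² dV`. -/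
def cIntegral₂ (U : Set (ℂ × ℂ)) (g : ℂ × ℂ → ℂ) : ℂ := (2 * Complex.I) ^ 2 * ∫ ζ in U, g ζ

/-- The integral operator `T` on the product domain `D₁ × D₂`. -/
def opT (D₁ D₂ : Set ℂ) (f : Form01) (z : ℂ × ℂ) : ℂ :=
  (-1 / (2 * Real.pi * Complex.I)) * cIntegral D₂ (fun ζ₂ => f.c₂ (z.1, ζ₂) / (ζ₂ - z.2)) +
  (-1 / (2 * Real.pi * Complex.I)) * cIntegral D₁ (fun ζ₁ => f.c₁ (ζ₁, z.2) / (ζ₁ - z.1)) +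
  (-1 / (2 * Real.pi * Complex.I) ^ 2) * cIntegral₂ (D₁ ×ˢ D₂)
    (fun ζ => scrD (D₁ ×ˢ D₂) f ζ / ((ζ.1 - z.1) * (ζ.2 - z.2)))

/-- `T f` is well defined on `D₁ × D₂`: the distribution `𝒟 f` is a locally integrable function,
and the three integrals in `T f` converge absolutely at almost every point. -/
def OpTWellDefined (D₁ D₂ : Set ℂ) (f : Form01) : Prop :=
  IsScrD (D₁ ×ˢ D₂) f (scrD (D₁ ×ˢ D₂) f) ∧
  ∀ᵐ z ∂(volume.restrict (D₁ ×ˢ D₂)),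
    IntegrableOn (fun ζ₂ => f.c₂ (z.1, ζ₂) / (ζ₂ - z.2)) D₂ volume ∧
    IntegrableOn (fun ζ₁ => f.c₁ (ζ₁, z.2) / (ζ₁ - z.1)) D₁ volume ∧
    IntegrableOn (fun ζ => scrD (D₁ ×ˢ D₂) f ζ / ((ζ.1 - z.1) * (ζ.2 - z.2))) (D₁ ×ˢ D₂) volume

/-- The form `f = (φ⁻¹)^* α` on the product of the disc and the punctured disc:
`f₁ = w̄₂ α̃₁` and `f₂ = w̄₁ α̃₁ + α̃₂` with `α̃ⱼ = αⱼ ∘ φ⁻¹`. -/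
def transfer (α : Form01) : Form01 where
  c₁ := fun w => conj w.2 * α.c₁ (phiInv w)
  c₂ := fun w => conj w.1 * α.c₁ (phiInv w) + α.c₂ (phiInv w)

end HartogsDbar

end

namespace HartogsDbar

noncomputable section

open Set Metric Filter Topology

/-! The relation `z̄₁α₁ + z̄₂α₂ = 0`, pulled back by `φ⁻¹`, reads `w̄₂ f₂ = 0`. Hence `f₂ = 0`
almost everywhere (`transfer_c₂_ae_eq_zero`), and closedness of `α` says that `f₁` is weakly
holomorphic in `w₂`. So `𝒟 f = 0` (`isScrD_transfer_zero`), and `T f` reduces to the Cauchy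
transform of `f₁ = w̄₂ α̃₁` in `w₁` (`opT_transfer_ae_eq`).

The estimate: `φ` carries Lebesgue measure on the Hartogs triangle to `|w₂|² dV`
(`measurePreserving_phi`). This weight is constant on the slices `w₂ = c`, so Schur's test for the
Cauchy kernel on the disc, integrated over `c`, gives the `L^p` bound (`eLpNorm_cauchyT_le`); the
factor `w̄₂` has modulus at most one.

The equation: `f₁` need not be integrable near `w₂ = 0`, but `A = w₂ f₁ = |w₂|² α̃₁` is, and the
holomorphic factor `w₂` commutes both with `∂̄` and with the Cauchy transform in `w₁`. By Fubini the
transform is dual to a Cauchy potential acting on test functions. Cauchy–Pompeiu then gives `∂̄₁` of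
the transform of `A` as `A` (`integral_cauchyT_dbar₁`), while `∂̄₂` commutes with the potential and
falls on `A`, giving zero (`integral_cauchyT_dbar₂`). The chain rule for `φ⁻¹` turns these two
identities into `∂̄v = α` (`isWeakSolution_cauchyT_comp_phi`). -/

/-! ### The Cauchy kernel in the plane and the Cauchy–Pompeiu formula. -/

/-- The Cauchy–Riemann operator in one variable. -/
def dbar (u : ℂ → ℂ) (t : ℂ) : ℂ :=
  (1 / 2) * (fderiv ℝ u t 1 + Complex.I * fderiv ℝ u t Complex.I)

/-- The mass of the Cauchy kernel on the disc of radius `R`. -/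
def kernelMass (R : ℝ) : ℝ≥0∞ := ∫⁻ η in ball (0 : ℂ) R, ‖η⁻¹‖ₑ

/-- In polar coordinates the Jacobian `r` cancels `|η|⁻¹`, leaving at most the area of a rectangle.
-/
theorem kernelMass_lt_top (R : ℝ) : kernelMass R < ∞ := by
  unfold kernelMass
  rw [← lintegral_indicator measurableSet_ball, ← Complex.lintegral_comp_polarCoord_symm]
  calc _ ≤ ∫⁻ p in polarCoord.target,
        (Ioo (0 : ℝ) R ×ˢ Ioo (-Real.pi) Real.pi).indicator 1 p := by
        refine setLIntegral_mono' polarCoord.open_target.measurableSet fun p hp => ?_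
        obtain ⟨h1, h2⟩ : 0 < p.1 ∧ p.2 ∈ Ioo (-Real.pi) Real.pi := hp
        by_cases h : ‖Complex.polarCoord.symm p‖ < R
        · have h' := h
          rw [Complex.norm_polarCoord_symm, abs_of_pos h1] at h'
          rw [indicator_of_mem (by simpa using h), indicator_of_mem (show p ∈ Ioo (0 : ℝ) R ×ˢ Ioo (-Real.pi) Real.pi from ⟨⟨h1, h'⟩, h2⟩),
            enorm_inv (by
              rw [← norm_ne_zero_iff, Complex.norm_polarCoord_symm]; exact (abs_pos.2 h1.ne').ne'),
            ← ofReal_norm, Complex.norm_polarCoord_symm, abs_of_pos h1, smul_eq_mul]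
          exact (ENNReal.mul_inv_cancel (by simpa using h1) ENNReal.ofReal_ne_top).le
        · rw [indicator_of_notMem (by simpa using h)]
          simp
    _ ≤ ∫⁻ p, (Ioo (0 : ℝ) R ×ˢ Ioo (-Real.pi) Real.pi).indicator 1 p :=
        setLIntegral_le_lintegral _ _
    _ = volume (Ioo (0 : ℝ) R ×ˢ Ioo (-Real.pi) Real.pi) :=
        lintegral_indicator_one (measurableSet_Ioo.prod measurableSet_Ioo)
    _ < ∞ := by
        rw [Measure.volume_eq_prod, Measure.prod_prod, Real.volume_Ioo, Real.volume_Ioo]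
        exact ENNReal.mul_lt_top ENNReal.ofReal_lt_top ENNReal.ofReal_lt_top

theorem integrableOn_inv_ball (R : ℝ) : IntegrableOn (fun η : ℂ => η⁻¹) (ball 0 R) :=
  ⟨measurable_inv.aestronglyMeasurable, kernelMass_lt_top R⟩

theorem locallyIntegrable_inv : LocallyIntegrable (fun η : ℂ => η⁻¹) := fun x =>
  ⟨ball 0 (‖x‖ + 1), isOpen_ball.mem_nhds (by simp), integrableOn_inv_ball _⟩

theorem lintegral_enorm_inv_sub_le {ζ : ℂ} {r : ℝ} (hζ : ‖ζ‖ ≤ r) (R : ℝ) :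
    ∫⁻ w in ball (0 : ℂ) R, ‖(w - ζ)⁻¹‖ₑ ≤ kernelMass (R + r) := by
  unfold kernelMass
  rw [← lintegral_indicator measurableSet_ball, ← lintegral_indicator measurableSet_ball,
    ← lintegral_sub_right_eq_self ((ball (0 : ℂ) (R + r)).indicator fun η => ‖η⁻¹‖ₑ) ζ]
  refine lintegral_mono fun w => ?_
  by_cases h : w ∈ ball (0 : ℂ) R
  · rw [indicator_of_mem h, indicator_of_mem]
    rw [mem_ball_zero_iff] at h ⊢
    linarith [norm_sub_le w ζ]
  · simp [indicator_of_notMem h]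

/-- The **Cauchy–Pompeiu formula** for compactly supported functions. -/
theorem integral_dbar_div {u : ℂ → ℂ} (hu : ContDiff ℝ 1 u) (hc : HasCompactSupport u) :
    ∫ t, t⁻¹ * dbar u t = -(Real.pi * u 0) := by
  have hud := hu.continuous_fderiv one_ne_zero
  have hdiff := hu.differentiable one_ne_zero
  set e : ℝ → ℂ := fun θ => Real.cos θ + Real.sin θ * Complex.I with he
  have hne : ∀ θ, e θ * (Real.cos θ - Real.sin θ * Complex.I) = 1 := fun θ => by
    have h : (Real.cos θ : ℂ) ^ 2 + (Real.sin θ : ℂ) ^ 2 = 1 := by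
      exact_mod_cast Real.cos_sq_add_sin_sq θ
    simp only [he]
    ring_nf
    rw [Complex.I_sq]
    linear_combination h
  have hec : Continuous e := by fun_prop
  obtain ⟨R, hR⟩ := hc.isCompact.isBounded.subset_ball 0
  have hnorm : ∀ θ, ‖e θ‖ = 1 := fun θ => by
    have := Complex.norm_polarCoord_symm (1, θ)
    rwa [Complex.polarCoord_symm_apply, Complex.ofReal_one, one_mul, abs_one] at this
  have hzero : ∀ r θ, R ≤ r → fderiv ℝ u (r * e θ) = 0 := fun r θ hr => by
    refine image_eq_zero_of_notMem_tsupport fun hmem => ?_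
    have := hR (tsupport_fderiv_subset ℝ hmem)
    rw [mem_ball_zero_iff, norm_mul, hnorm, mul_one, Complex.norm_real] at this
    linarith [Real.le_norm_self r]
  -- For `t = r e^{iθ}`, `r t⁻¹ ∂̄u = (∂_r u + (i/r) ∂_θ u) / 2`; `g₁` is `∂_r u` and `g₂` is `(1/r)
  -- ∂_θ u`.
  set g₁ : ℝ × ℝ → ℂ := fun p => fderiv ℝ u (p.1 * e p.2) (e p.2) with hg₁
  set g₂ : ℝ × ℝ → ℂ := fun p => fderiv ℝ u (p.1 * e p.2) (Complex.I * e p.2) with hg₂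
  have hcont : ∀ c : ℂ, Continuous fun p : ℝ × ℝ => fderiv ℝ u (p.1 * e p.2) (c * e p.2) :=
    fun c => by
      have h1 : Continuous fun p : ℝ × ℝ => fderiv ℝ u (p.1 * e p.2) := by fun_prop
      have h2 : Continuous fun p : ℝ × ℝ => c * e p.2 := by fun_prop
      exact h1.clm_apply h2
  have hint : ∀ c : ℂ, IntegrableOn (fun p : ℝ × ℝ => fderiv ℝ u (p.1 * e p.2) (c * e p.2))
      (Ioi 0 ×ˢ Ioo (-Real.pi) Real.pi) := fun c => by
    have h1 : IntegrableOn (fun p : ℝ × ℝ => fderiv ℝ u (p.1 * e p.2) (c * e p.2))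
        (Icc 0 R ×ˢ Icc (-Real.pi) Real.pi) :=
      (hcont c).continuousOn.integrableOn_compact (isCompact_Icc.prod isCompact_Icc)
    refine h1.of_forall_sdiff_eq_zero (measurableSet_Ioi.prod measurableSet_Ioo) fun p hp => ?_
    have : R ≤ p.1 := by
      by_contra! h
      exact hp.2 ⟨⟨le_of_lt hp.1.1, h.le⟩, Ioo_subset_Icc_self hp.1.2⟩
    simp [hzero p.1 p.2 this]
  have hi₁ : IntegrableOn g₁ (Ioi 0 ×ˢ Ioo (-Real.pi) Real.pi) := by simpa using hint 1
  have hi₂ : IntegrableOn g₂ (Ioi 0 ×ˢ Ioo (-Real.pi) Real.pi) := hint Complex.I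
  have key : ∀ p ∈ polarCoord.target,
      p.1 • ((Complex.polarCoord.symm p)⁻¹ * dbar u (Complex.polarCoord.symm p)) =
        (1 / 2) * (g₁ p + Complex.I * g₂ p) := fun p hp => by
    have hp1 : (p.1 : ℂ) ≠ 0 := by exact_mod_cast (hp.1 : 0 < p.1).ne'
    have hpe : e p.2 ≠ 0 := left_ne_zero_of_mul_eq_one (hne p.2)
    have h1 : e p.2 = Real.cos p.2 • (1 : ℂ) + Real.sin p.2 • Complex.I := by
      simp [he, Complex.real_smul]
    have h2 : Complex.I * e p.2 = Real.cos p.2 • Complex.I + (-Real.sin p.2) • (1 : ℂ) := by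
      rw [h1]
      simp only [Complex.real_smul, Complex.ofReal_neg]
      linear_combination (Real.sin p.2 : ℂ) * Complex.I_mul_I
    have h3 : (e p.2)⁻¹ = Real.cos p.2 - Real.sin p.2 * Complex.I :=
      inv_eq_of_mul_eq_one_right (hne p.2)
    have h4 : Complex.polarCoord.symm p = p.1 * e p.2 := Complex.polarCoord_symm_apply p
    simp only [hg₁, hg₂, h4, dbar]
    generalize fderiv ℝ u (p.1 * e p.2) = L
    have hL1 : L (e p.2) = Real.cos p.2 * L 1 + Real.sin p.2 * L Complex.I := by
      rw [h1, map_add, map_smul, map_smul]; simp [Complex.real_smul]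
    have hL2 : L (Complex.I * e p.2) = Real.cos p.2 * L Complex.I - Real.sin p.2 * L 1 := by
      rw [h2, map_add, map_smul, map_smul]; simp [Complex.real_smul]; ring
    rw [hL1, hL2, mul_inv, h3, Complex.real_smul]
    field_simp
    linear_combination (-(Real.sin p.2 : ℂ) * L Complex.I) * Complex.I_sq
  -- Fundamental theorem of calculus along a ray, at whose far end `u` vanishes.
  have hr : ∀ θ, ∫ r in Ioi (0 : ℝ), g₁ (r, θ) = -u 0 := fun θ => by
    have hd : ∀ r : ℝ, HasDerivAt (fun r : ℝ => u (r * e θ)) (g₁ (r, θ)) r := fun r => by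
      have h : HasDerivAt (fun r : ℝ => u (r * e θ)) (fderiv ℝ u (r * e θ) (1 * e θ)) r :=
        (hdiff (r * e θ)).hasFDerivAt.comp_hasDerivAt r
          ((Complex.ofRealCLM.hasDerivAt (x := r)).mul_const (e θ))
      rwa [one_mul] at h
    have hcg : HasCompactSupport fun r : ℝ => g₁ (r, θ) := by
      refine HasCompactSupport.of_support_subset_isCompact (isCompact_Icc (a := -R) (b := R)) ?_
      intro r hr
      by_contra h
      apply hr
      have hle : R ≤ |r| := by
        by_contra! h'
        exact h ⟨(abs_lt.1 h').1.le, (abs_lt.1 h').2.le⟩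
      simp only [hg₁]
      rw [image_eq_zero_of_notMem_tsupport (f := fderiv ℝ u) fun hmem => ?_,
        _root_.zero_apply]
      have := hR (tsupport_fderiv_subset ℝ hmem)
      rw [mem_ball_zero_iff, norm_mul, hnorm, mul_one, Complex.norm_real, Real.norm_eq_abs] at this
      linarith
    have hcg' : Continuous fun r : ℝ => g₁ (r, θ) := by
      have := (hcont 1).comp (Continuous.prodMk_left θ)
      simpa [hg₁, Function.comp_def] using this
    have := integral_Ioi_of_hasDerivAt_of_tendsto' (a := 0) (m := 0) (fun r _ => hd r)
      (hcg'.integrable_of_hasCompactSupport hcg).integrableOn ?_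
    · simpa using this
    · refine tendsto_const_nhds.congr' ?_
      filter_upwards [eventually_ge_atTop R] with r hr
      refine (image_eq_zero_of_notMem_tsupport fun hmem => ?_).symm
      have := hR hmem
      rw [mem_ball_zero_iff, norm_mul, hnorm, mul_one, Complex.norm_real] at this
      linarith [Real.le_norm_self r]
  -- On each circle `r g₂` is the derivative of a `2π`-periodic function of `θ`.
  have hθ : ∀ r ∈ Ioi (0 : ℝ), ∫ θ in Ioo (-Real.pi) Real.pi, g₂ (r, θ) = 0 := fun r hr => by
    have hed : ∀ θ : ℝ, HasDerivAt e (Complex.I * e θ) θ := fun θ => by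
      have h := ((Real.hasDerivAt_cos θ).ofReal_comp).add
        (((Real.hasDerivAt_sin θ).ofReal_comp).mul_const Complex.I)
      refine h.congr_deriv ?_
      simp only [he]
      push_cast
      linear_combination -(Complex.sin θ) * Complex.I_mul_I
    have hd : ∀ θ : ℝ, HasDerivAt (fun θ : ℝ => u (r * e θ)) (r * g₂ (r, θ)) θ := fun θ => by
      have h : HasDerivAt (fun θ : ℝ => u (r * e θ))
          (fderiv ℝ u (r * e θ) (r * (Complex.I * e θ))) θ :=
        (hdiff (r * e θ)).hasFDerivAt.comp_hasDerivAt θ ((hed θ).const_mul (r : ℂ))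
      refine h.congr_deriv ?_
      rw [show (r : ℂ) * (Complex.I * e θ) = r • (Complex.I * e θ) from Complex.real_smul.symm,
        map_smul]
      exact Complex.real_smul
    have hcg : Continuous fun θ : ℝ => g₂ (r, θ) := (hcont Complex.I).comp (Continuous.prodMk_right r)
    have h := intervalIntegral.integral_eq_sub_of_hasDerivAt (a := -Real.pi) (b := Real.pi)
      (fun θ _ => hd θ) ((continuous_const.mul hcg).intervalIntegrable _ _)
    rw [intervalIntegral.integral_const_mul] at h
    have h0 : (r : ℂ) ≠ 0 := by exact_mod_cast (mem_Ioi.1 hr).ne'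
    simp only [he, Real.cos_neg, Real.sin_neg, Real.sin_pi, neg_zero, sub_self] at h
    rw [← integral_Ioc_eq_integral_Ioo, ← intervalIntegral.integral_of_le (by
      linarith [Real.pi_pos])]
    exact (mul_eq_zero.1 h).resolve_left h0
  rw [← Complex.integral_comp_polarCoord_symm,
    setIntegral_congr_fun polarCoord.open_target.measurableSet key, polarCoord_target,
    integral_const_mul, integral_add hi₁ (hi₂.const_mul _), integral_const_mul,
    Measure.volume_eq_prod, setIntegral_prod _ hi₂, setIntegral_congr_fun measurableSet_Ioi hθ]
  have hsw : ∫ p in Ioi (0 : ℝ) ×ˢ Ioo (-Real.pi) Real.pi, g₁ p ∂(volume.prod volume) =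
      ∫ θ in Ioo (-Real.pi) Real.pi, ∫ r in Ioi (0 : ℝ), g₁ (r, θ) := by
    rw [← Measure.prod_restrict]
    refine integral_prod_symm _ ?_
    rw [Measure.prod_restrict]
    exact hi₁
  rw [hsw]
  simp only [hr, integral_const, mul_zero, add_zero, measureReal_restrict_apply_univ,
    Real.volume_real_Ioo_of_le (by linarith [Real.pi_pos] : -Real.pi ≤ Real.pi), Complex.real_smul]
  push_cast
  ring

/-! ### Calculus of the two Cauchy–Riemann operators. -/

theorem dbar₁_mul {f g : ℂ × ℂ → ℂ} {z : ℂ × ℂ} (hf : DifferentiableAt ℝ f z)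
    (hg : DifferentiableAt ℝ g z) :
    dbar₁ (fun w => f w * g w) z = f z * dbar₁ g z + dbar₁ f z * g z := by
  simp only [dbar₁, fderiv_fun_mul hf hg]
  simp
  ring

theorem dbar₂_mul {f g : ℂ × ℂ → ℂ} {z : ℂ × ℂ} (hf : DifferentiableAt ℝ f z)
    (hg : DifferentiableAt ℝ g z) :
    dbar₂ (fun w => f w * g w) z = f z * dbar₂ g z + dbar₂ f z * g z := by
  simp only [dbar₂, fderiv_fun_mul hf hg]
  simp
  ring

theorem dbar₂_comp_fst {κ : ℂ → ℂ} {z : ℂ × ℂ} (hκ : DifferentiableAt ℝ κ z.1) :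
    dbar₂ (fun w => κ w.1) z = 0 := by
  have h : fderiv ℝ (fun w : ℂ × ℂ => κ w.1) z =
      (fderiv ℝ κ z.1).comp (ContinuousLinearMap.fst ℝ ℂ ℂ) :=
    (hκ.hasFDerivAt.comp z hasFDerivAt_fst).fderiv
  simp [dbar₂, h]

theorem continuous_dbar₁ {χ : ℂ × ℂ → ℂ} (hχ : ContDiff ℝ ((⊤ : ℕ∞) : WithTop ℕ∞) χ) :
    Continuous (dbar₁ χ) := by
  have := hχ.continuous_fderiv (by simp)
  unfold dbar₁
  fun_prop

theorem continuous_dbar₂ {χ : ℂ × ℂ → ℂ} (hχ : ContDiff ℝ ((⊤ : ℕ∞) : WithTop ℕ∞) χ) :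
    Continuous (dbar₂ χ) := by
  have := hχ.continuous_fderiv (by simp)
  unfold dbar₂
  fun_prop

theorem support_dbar₁_subset (χ : ℂ × ℂ → ℂ) : Function.support (dbar₁ χ) ⊆ tsupport χ := by
  intro z hz
  by_contra h
  refine hz ?_
  have : fderiv ℝ χ z = 0 :=
    image_eq_zero_of_notMem_tsupport fun h' => h (tsupport_fderiv_subset ℝ h')
  simp [dbar₁, this]

theorem support_dbar₂_subset (χ : ℂ × ℂ → ℂ) : Function.support (dbar₂ χ) ⊆ tsupport χ := by
  intro z hz
  by_contra h
  refine hz ?_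
  have : fderiv ℝ χ z = 0 :=
    image_eq_zero_of_notMem_tsupport fun h' => h (tsupport_fderiv_subset ℝ h')
  simp [dbar₂, this]

theorem hasCompactSupport_dbar₁ {χ : ℂ × ℂ → ℂ} (hc : HasCompactSupport χ) :
    HasCompactSupport (dbar₁ χ) :=
  hc.of_isClosed_subset (isClosed_tsupport _)
    (closure_minimal (support_dbar₁_subset χ) (isClosed_tsupport _))

theorem hasCompactSupport_dbar₂ {χ : ℂ × ℂ → ℂ} (hc : HasCompactSupport χ) :
    HasCompactSupport (dbar₂ χ) :=
  hc.of_isClosed_subset (isClosed_tsupport _)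
    (closure_minimal (support_dbar₂_subset χ) (isClosed_tsupport _))

/-! ### The Cauchy potential of a test function in the first variable. -/

/-- The kernel `-1 / (π t)`. -/
def kernel (t : ℂ) : ℂ := -(Real.pi * t)⁻¹

theorem locallyIntegrable_kernel : LocallyIntegrable kernel := by
  have := locallyIntegrable_inv.smul (-(Real.pi : ℂ)⁻¹)
  refine this.congr (Eventually.of_forall fun t => ?_)
  simp [kernel, mul_comm]

/-- The Cauchy potential of `χ` in the first variable. -/
def cauchyPot (χ : ℂ × ℂ → ℂ) (z : ℂ × ℂ) : ℂ := ∫ t, kernel t * χ (z.1 - t, z.2)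

/-- Substitution `w = z₁ - t`. The defining form puts derivatives on `χ`; this one is suited to
Fubini. -/
theorem cauchyPot_eq (χ : ℂ × ℂ → ℂ) (z : ℂ × ℂ) :
    cauchyPot χ z = ∫ w, (Real.pi * (w - z.1))⁻¹ * χ (w, z.2) := by
  unfold cauchyPot kernel
  rw [← integral_sub_left_eq_self _ _ z.1]
  congr with w
  rw [sub_sub_cancel, ← inv_neg, ← mul_neg, neg_sub]

open scoped Convolution in
theorem cauchyPot_eq_convolution (χ : ℂ × ℂ → ℂ) :
    cauchyPot χ = (fun q : ℂ × ℂ => (kernel ⋆[ContinuousLinearMap.mul ℝ ℂ, volume]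
      (fun p x => χ (x, p)) q.1) q.2) ∘ Prod.swap := by
  ext z
  simp [cauchyPot, convolution_def]

theorem eq_zero_of_notMem_image_fst {χ : ℂ × ℂ → ℂ} {p x : ℂ}
    (hx : x ∉ Prod.fst '' tsupport χ) : χ (x, p) = 0 :=
  image_eq_zero_of_notMem_tsupport fun h => hx ⟨_, h, rfl⟩

/-- A locally integrable kernel convolved with a smooth compactly supported function is smooth, here
with `z₂` as a parameter; the swap of coordinates puts the parameter first. -/
theorem contDiff_cauchyPot {χ : ℂ × ℂ → ℂ} (hχ : ContDiff ℝ ((⊤ : ℕ∞) : WithTop ℕ∞) χ)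
    (hc : HasCompactSupport χ) : ContDiff ℝ ((⊤ : ℕ∞) : WithTop ℕ∞) (cauchyPot χ) := by
  rw [cauchyPot_eq_convolution]
  refine ContDiff.comp ?_
    (contDiff_snd.prodMk contDiff_fst : ContDiff ℝ _ fun q : ℂ × ℂ => (q.2, q.1))
  rw [← contDiffOn_univ, ← univ_prod_univ]
  refine contDiffOn_convolution_right_with_param (P := ℂ) (g := fun p x => χ (x, p)) _ isOpen_univ
    (hc.isCompact.image continuous_fst) (fun p x _ hx => eq_zero_of_notMem_image_fst hx)
    locallyIntegrable_kernel ?_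
  exact (hχ.comp (contDiff_snd.prodMk contDiff_fst)).contDiffOn

theorem fderiv_cauchyPot {χ : ℂ × ℂ → ℂ} (hχ : ContDiff ℝ ((⊤ : ℕ∞) : WithTop ℕ∞) χ)
    (hc : HasCompactSupport χ) (z v : ℂ × ℂ) :
    fderiv ℝ (cauchyPot χ) z v = ∫ t, kernel t * fderiv ℝ χ (z.1 - t, z.2) v := by
  have h1 : ContDiff ℝ 1 (fun q : ℂ × ℂ => χ (q.2, q.1)) :=
    (hχ.of_le (by simp)).comp (contDiff_snd.prodMk contDiff_fst)
  have h := hasFDerivAt_convolution_right_with_param (μ := volume) (ContinuousLinearMap.mul ℝ ℂ)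
    (g := fun p x => χ (x, p)) (s := univ) isOpen_univ (hc.isCompact.image continuous_fst)
    (fun p x _ hx => eq_zero_of_notMem_image_fst hx) locallyIntegrable_kernel
    h1.contDiffOn z.swap (mem_univ _)
  have hsw : HasFDerivAt (Prod.swap : ℂ × ℂ → ℂ × ℂ)
      (ContinuousLinearEquiv.prodComm ℝ ℂ ℂ : ℂ × ℂ →L[ℝ] ℂ × ℂ) z :=
    (ContinuousLinearEquiv.prodComm ℝ ℂ ℂ : ℂ × ℂ →L[ℝ] ℂ × ℂ).hasFDerivAt
  have h2 := h.comp z hsw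
  have hsl : ∀ x, fderiv ℝ (fun q : ℂ × ℂ => χ (q.2, q.1)) (z.2, x) v.swap =
      fderiv ℝ χ (x, z.2) v := fun x => by
    have hsw' : HasFDerivAt (Prod.swap : ℂ × ℂ → ℂ × ℂ)
      (ContinuousLinearEquiv.prodComm ℝ ℂ ℂ : ℂ × ℂ →L[ℝ] ℂ × ℂ) (z.2, x) :=
      (ContinuousLinearEquiv.prodComm ℝ ℂ ℂ : ℂ × ℂ →L[ℝ] ℂ × ℂ).hasFDerivAt
    have h3 := (hχ.differentiable (by simp) (x, z.2)).hasFDerivAt.comp (z.2, x) hsw'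
    have h4 := h3.fderiv
    change fderiv ℝ (χ ∘ Prod.swap) (z.2, x) v.swap = _
    rw [h4]
    simp
  rw [cauchyPot_eq_convolution, h2.fderiv, ContinuousLinearMap.comp_apply]
  have hcs : HasCompactSupport fun x : ℂ => fderiv ℝ (fun q : ℂ × ℂ => χ (q.2, q.1)) (z.2, x) := by
    refine HasCompactSupport.of_support_subset_isCompact (hc.isCompact.image continuous_fst) ?_
    intro x hx
    by_contra hn
    refine hx (image_eq_zero_of_notMem_tsupport (f := fderiv ℝ _) fun hm => hn ?_)
    have := tsupport_fderiv_subset ℝ hm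
    have h5 := tsupport_comp_subset_preimage χ (f := fun q : ℂ × ℂ => (q.2, q.1))
      (continuous_snd.prodMk continuous_fst) this
    exact ⟨_, h5, rfl⟩
  have hcont : Continuous fun x : ℂ => fderiv ℝ (fun q : ℂ × ℂ => χ (q.2, q.1)) (z.2, x) :=
    (h1.continuous_fderiv one_ne_zero).comp (Continuous.prodMk_right _)
  have h6 := convolution_precompR_apply (μ := volume) (ContinuousLinearMap.mul ℝ ℂ)
    locallyIntegrable_kernel hcs hcont z.1 v.swap
  refine h6.trans ?_
  simp only [hsl, convolution_def]
  simp

theorem dbar₂_cauchyPot {χ : ℂ × ℂ → ℂ} (hχ : ContDiff ℝ ((⊤ : ℕ∞) : WithTop ℕ∞) χ)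
    (hc : HasCompactSupport χ) (z : ℂ × ℂ) :
    dbar₂ (cauchyPot χ) z = cauchyPot (dbar₂ χ) z := by
  have hint : ∀ v : ℂ × ℂ, Integrable fun t => kernel t * fderiv ℝ χ (z.1 - t, z.2) v :=
    fun v => by
    have hcont : Continuous fun t : ℂ => fderiv ℝ χ (z.1 - t, z.2) v :=
      ((hχ.continuous_fderiv (by simp)).comp (by fun_prop : Continuous fun t : ℂ =>
        (z.1 - t, z.2))).clm_apply continuous_const
    refine locallyIntegrable_kernel.integrable_smul_right_of_hasCompactSupport hcont ?_
    refine HasCompactSupport.of_support_subset_isCompact ((hc.isCompact.image continuous_fst).image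
      (continuous_const.sub continuous_id : Continuous fun t => z.1 - t)) fun t ht => ?_
    by_contra hn
    refine ht ?_
    beta_reduce
    rw [image_eq_zero_of_notMem_tsupport (f := fderiv ℝ χ), _root_.zero_apply]
    exact fun hm => hn ⟨z.1 - t, ⟨_, tsupport_fderiv_subset ℝ hm, rfl⟩, sub_sub_cancel _ _⟩
  unfold dbar₂
  rw [fderiv_cauchyPot hχ hc, fderiv_cauchyPot hχ hc, ← integral_const_mul, ← integral_add (hint _)
    ((hint _).const_mul _), ← integral_const_mul]
  unfold cauchyPot
  congr with t
  ring

/-- Cauchy–Pompeiu for `t ↦ χ (z₁ - t, z₂)`; the sign from this reflection cancels the one in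
`kernel`. -/
theorem cauchyPot_dbar₁ {χ : ℂ × ℂ → ℂ} (hχ : ContDiff ℝ ((⊤ : ℕ∞) : WithTop ℕ∞) χ)
    (hc : HasCompactSupport χ) (z : ℂ × ℂ) : cauchyPot (dbar₁ χ) z = -χ z := by
  have hu : ContDiff ℝ 1 fun t : ℂ => χ (z.1 - t, z.2) :=
    (hχ.of_le (by simp)).comp ((contDiff_const.sub contDiff_id).prodMk contDiff_const)
  have huc : HasCompactSupport fun t : ℂ => χ (z.1 - t, z.2) := by
    refine HasCompactSupport.of_support_subset_isCompact ((hc.isCompact.image continuous_fst).image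
      (continuous_const.sub continuous_id : Continuous fun t => z.1 - t)) fun t ht => ?_
    exact ⟨z.1 - t, ⟨_, subset_tsupport _ ht, rfl⟩, sub_sub_cancel _ _⟩
  have hd : ∀ t, dbar₁ χ (z.1 - t, z.2) = -dbar (fun t : ℂ => χ (z.1 - t, z.2)) t := fun t => by
    have h1 : HasFDerivAt (fun t : ℂ => (z.1 - t, z.2))
        ((-ContinuousLinearMap.id ℝ ℂ).prod 0) t :=
      ((hasFDerivAt_id t).const_sub z.1).prodMk (hasFDerivAt_const _ _)
    have h2 := ((hχ.differentiable (by simp) (z.1 - t, z.2)).hasFDerivAt.comp t h1).fderiv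
    have h3 : ∀ v : ℂ, fderiv ℝ (fun t : ℂ => χ (z.1 - t, z.2)) t v =
        -fderiv ℝ χ (z.1 - t, z.2) (v, 0) := fun v => by
      have : fderiv ℝ (fun t : ℂ => χ (z.1 - t, z.2)) t v =
        fderiv ℝ χ (z.1 - t, z.2) (-v, 0) := by
        change fderiv ℝ (χ ∘ fun t : ℂ => (z.1 - t, z.2)) t v = _
        rw [h2]
        simp
      rw [this, ← map_neg]
      simp
    simp only [dbar, dbar₁, h3]
    ring
  have h := integral_dbar_div hu huc
  have hpi : (Real.pi : ℂ) ≠ 0 := by exact_mod_cast Real.pi_ne_zero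
  unfold cauchyPot
  calc _ = ∫ t, (Real.pi : ℂ)⁻¹ * (t⁻¹ * dbar (fun t : ℂ => χ (z.1 - t, z.2)) t) := by
        congr with t
        rw [hd, kernel, mul_inv]
        ring
    _ = _ := by
        rw [integral_const_mul, h, sub_zero]
        field_simp

/-! ### The Cauchy transform and its duality with the Cauchy potential. -/

/-- The permutation `((w₁, w₂), ζ) ↦ ((ζ, w₂), w₁)`. -/
def exchange : (ℂ × ℂ) × ℂ ≃ᵐ (ℂ × ℂ) × ℂ :=
  MeasurableEquiv.prodAssoc.trans
    (MeasurableEquiv.prodComm.trans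
      (MeasurableEquiv.prodCongr MeasurableEquiv.prodComm (MeasurableEquiv.refl ℂ)))

@[simp]
theorem exchange_apply (q : (ℂ × ℂ) × ℂ) : exchange q = ((q.2, q.1.2), q.1.1) := rfl

theorem measurePreserving_exchange : MeasurePreserving exchange := by
  have h1 : MeasurePreserving (MeasurableEquiv.prodAssoc : (ℂ × ℂ) × ℂ ≃ᵐ ℂ × ℂ × ℂ) :=
    measurePreserving_prodAssoc _ _ _
  have h2 : MeasurePreserving (Prod.swap : ℂ × ℂ × ℂ → (ℂ × ℂ) × ℂ) :=
    Measure.measurePreserving_swap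
  have h3 : MeasurePreserving (Prod.map Prod.swap id : (ℂ × ℂ) × ℂ → (ℂ × ℂ) × ℂ) :=
    (Measure.measurePreserving_swap (μ := (volume : Measure ℂ)) (ν := (volume : Measure ℂ))).prod
      (MeasurePreserving.id volume)
  exact (h3.comp h2).comp h1

/-- The Cauchy transform of `A` in the first variable. -/
def cauchyT (A : ℂ × ℂ → ℂ) (w : ℂ × ℂ) : ℂ := ∫ ζ, A (ζ, w.2) * (Real.pi * (w.1 - ζ))⁻¹

section Kernel

variable {A χ : ℂ × ℂ → ℂ} {B R : ℝ}

/-- This justifies the Fubini exchanges: the integral in `w` runs over a disc of radius `R` around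
`0` and the pole lies in the unit disc, so it is bounded uniformly, leaving the `L¹` norm of `A`. -/
theorem integrable_mul_kernel (hA : Integrable A) (hA0 : ∀ z, 1 ≤ ‖z.1‖ → A z = 0)
    (hχ : Measurable χ) (hB : ∀ z, ‖χ z‖ ≤ B) (hR : ∀ z, R ≤ ‖z.1‖ → χ z = 0) :
    Integrable fun q : (ℂ × ℂ) × ℂ =>
      A q.1 * ((Real.pi * (q.2 - q.1.1))⁻¹ * χ (q.2, q.1.2)) := by
  have hm : Measurable fun q : (ℂ × ℂ) × ℂ => (Real.pi * (q.2 - q.1.1))⁻¹ * χ (q.2, q.1.2) := by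
    fun_prop
  have hsm : AEStronglyMeasurable (fun q : (ℂ × ℂ) × ℂ =>
      A q.1 * ((Real.pi * (q.2 - q.1.1))⁻¹ * χ (q.2, q.1.2))) volume :=
    hA.aestronglyMeasurable.comp_fst.mul hm.aestronglyMeasurable
  refine ⟨hsm, ?_⟩
  set c : ℝ≥0∞ := ‖(Real.pi : ℂ)⁻¹‖ₑ * ENNReal.ofReal B with hc
  have hctop : c ≠ ∞ := ENNReal.mul_ne_top enorm_ne_top ENNReal.ofReal_ne_top
  unfold HasFiniteIntegral
  rw [Measure.volume_eq_prod, lintegral_prod _ hsm.enorm]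
  calc _ ≤ ∫⁻ z, ‖A z‖ₑ * (c * kernelMass (R + 1)) := by
        refine lintegral_mono fun z => ?_
        by_cases hz : 1 ≤ ‖z.1‖
        · simp [hA0 z hz]
        simp only [enorm_mul]
        rw [lintegral_const_mul' _ _ enorm_ne_top]
        gcongr
        calc _ ≤ ∫⁻ w, c * (ball (0 : ℂ) R).indicator (fun w => ‖(w - z.1)⁻¹‖ₑ) w := by
              refine lintegral_mono fun w => ?_
              by_cases hw : R ≤ ‖w‖
              · simp [hR (w, z.2) hw]
              · rw [indicator_of_mem (by simpa using hw), mul_inv, enorm_mul, hc,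
                  mul_right_comm]
                gcongr
                rw [← ofReal_norm]
                exact ENNReal.ofReal_le_ofReal (hB _)
          _ ≤ _ := by
              rw [lintegral_const_mul' _ _ hctop, lintegral_indicator measurableSet_ball]
              gcongr
              exact lintegral_enorm_inv_sub_le (not_le.1 hz).le R
    _ < ∞ := by
        rw [lintegral_mul_const' _ _ (ENNReal.mul_ne_top hctop (kernelMass_lt_top _).ne)]
        exact ENNReal.mul_lt_top hA.hasFiniteIntegral
          (ENNReal.mul_lt_top hctop.lt_top (kernelMass_lt_top _))

theorem integrable_mul_kernel' (hA : Integrable A) (hA0 : ∀ z, 1 ≤ ‖z.1‖ → A z = 0)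
    (hχ : Measurable χ) (hB : ∀ z, ‖χ z‖ ≤ B) (hR : ∀ z, R ≤ ‖z.1‖ → χ z = 0) :
    Integrable fun q : (ℂ × ℂ) × ℂ =>
      A (q.2, q.1.2) * (Real.pi * (q.1.1 - q.2))⁻¹ * χ q.1 := by
  have h := integrable_mul_kernel hA hA0 hχ hB hR
  refine ((measurePreserving_exchange.integrable_comp h.aestronglyMeasurable).2 h).congr
    (Eventually.of_forall fun q => ?_)
  simp [mul_assoc]

theorem integrable_cauchyT_mul (hA : Integrable A) (hA0 : ∀ z, 1 ≤ ‖z.1‖ → A z = 0)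
    (hχ : Measurable χ) (hB : ∀ z, ‖χ z‖ ≤ B) (hR : ∀ z, R ≤ ‖z.1‖ → χ z = 0) :
    Integrable fun w => cauchyT A w * χ w := by
  have h := (integrable_mul_kernel' hA hA0 hχ hB hR).integral_prod_left
  exact h.congr (Eventually.of_forall fun w => integral_mul_const (χ w) fun ζ =>
    A (ζ, w.2) * (Real.pi * (w.1 - ζ))⁻¹)

theorem integrable_mul_cauchyPot (hA : Integrable A) (hA0 : ∀ z, 1 ≤ ‖z.1‖ → A z = 0)
    (hχ : Measurable χ) (hB : ∀ z, ‖χ z‖ ≤ B) (hR : ∀ z, R ≤ ‖z.1‖ → χ z = 0) :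
    Integrable fun z => A z * cauchyPot χ z := by
  have h := (integrable_mul_kernel hA hA0 hχ hB hR).integral_prod_left
  refine h.congr (Eventually.of_forall fun z => ?_)
  beta_reduce
  rw [cauchyPot_eq]
  exact integral_const_mul (A z) fun w => (Real.pi * (w - z.1))⁻¹ * χ (w, z.2)

/-- The two operators are adjoint: `exchange` swaps the pole and the evaluation point in the triple
integral. -/
theorem integral_cauchyT_mul (hA : Integrable A) (hA0 : ∀ z, 1 ≤ ‖z.1‖ → A z = 0)
    (hχ : Measurable χ) (hB : ∀ z, ‖χ z‖ ≤ B) (hR : ∀ z, R ≤ ‖z.1‖ → χ z = 0) :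
    ∫ w, cauchyT A w * χ w = ∫ z, A z * cauchyPot χ z := by
  have h := integrable_mul_kernel hA hA0 hχ hB hR
  have h' := integrable_mul_kernel' hA hA0 hχ hB hR
  calc _ = ∫ w, ∫ ζ, A (ζ, w.2) * (Real.pi * (w.1 - ζ))⁻¹ * χ w := by
        congr with w
        exact (integral_mul_const _ _).symm
    _ = ∫ q : (ℂ × ℂ) × ℂ, A (q.2, q.1.2) * (Real.pi * (q.1.1 - q.2))⁻¹ * χ q.1 :=
        (integral_prod _ h').symm
    _ = ∫ q : (ℂ × ℂ) × ℂ, A q.1 * ((Real.pi * (q.2 - q.1.1))⁻¹ * χ (q.2, q.1.2)) := by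
        rw [← measurePreserving_exchange.integral_comp exchange.measurableEmbedding]
        simp [mul_assoc]
    _ = ∫ z, ∫ w, A z * ((Real.pi * (w - z.1))⁻¹ * χ (w, z.2)) := integral_prod _ h
    _ = _ := by
        congr with z
        rw [cauchyPot_eq]
        exact integral_const_mul _ _

theorem exists_bound_of_hasCompactSupport (hχ : Continuous χ) (hc : HasCompactSupport χ) :
    ∃ B R : ℝ, (∀ z, ‖χ z‖ ≤ B) ∧ ∀ z, R ≤ ‖z.1‖ → χ z = 0 := by
  obtain ⟨B, hB⟩ := hχ.bounded_above_of_compact_support hc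
  obtain ⟨R, hR⟩ := hc.isCompact.isBounded.subset_ball 0
  refine ⟨B, R, hB, fun z hz => image_eq_zero_of_notMem_tsupport fun h => ?_⟩
  have := hR h
  rw [mem_ball_zero_iff] at this
  exact absurd (hz.trans (norm_fst_le z)) (not_le.2 this)

theorem integral_cauchyT_dbar₁ (hA : Integrable A) (hA0 : ∀ z, 1 ≤ ‖z.1‖ → A z = 0)
    (hχ : ContDiff ℝ ((⊤ : ℕ∞) : WithTop ℕ∞) χ) (hc : HasCompactSupport χ) :
    ∫ w, cauchyT A w * dbar₁ χ w = -∫ w, A w * χ w := by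
  obtain ⟨B, R, hB, hR⟩ := exists_bound_of_hasCompactSupport (continuous_dbar₁ hχ)
    (hasCompactSupport_dbar₁ hc)
  rw [integral_cauchyT_mul hA hA0 (continuous_dbar₁ hχ).measurable hB hR, ← integral_neg]
  simp [cauchyPot_dbar₁ hχ hc]

/-- A smooth cutoff function on the disc, equal to one on the disc of radius `1 - 1 / (n + 2)`. -/
def cutoff (n : ℕ) : ContDiffBump (0 : ℂ) where
  rIn := 1 - 1 / (n + 2)
  rOut := 1 - 1 / (n + 3)
  rIn_pos := by
    have : (1 : ℝ) / (n + 2) < 1 := by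
      rw [div_lt_one (by positivity)]
      linarith [(Nat.cast_nonneg n : (0 : ℝ) ≤ n)]
    linarith
  rIn_lt_rOut := by
    have : (1 : ℝ) / (n + 3) < 1 / (n + 2) :=
      one_div_lt_one_div_of_lt (by positivity) (by linarith)
    linarith

theorem tendsto_cutoff {ζ : ℂ} (hζ : ‖ζ‖ < 1) :
    Tendsto (fun n => ((cutoff n ζ : ℝ) : ℂ)) atTop (𝓝 1) := by
  have h : Tendsto (fun n : ℕ => (1 : ℝ) - 1 / (n + 2)) atTop (𝓝 1) := by
    have h1 : Tendsto (fun n : ℕ => ((n + 2 : ℕ) : ℝ)⁻¹) atTop (𝓝 0) :=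
      tendsto_inv_atTop_zero.comp (tendsto_natCast_atTop_atTop.comp (tendsto_add_atTop_nat 2))
    simpa using h1.const_sub 1
  refine tendsto_const_nhds.congr' ?_
  filter_upwards [h.eventually (lt_mem_nhds hζ)] with n hn
  rw [(cutoff n).one_of_mem_closedBall]
  · simp
  · rw [mem_closedBall_zero_iff]
    exact hn.le

/-- By duality the integral is that of `A` against `∂̄₂` of the potential of `χ`. The potential need
not be a test function, as it may fail to vanish near `|z₁| = 1`. Cutoffs in `z₁` alone repair this,
since `∂̄₂` does not see them, and they are removed by dominated convergence because `A` vanishes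
for `|z₁| ≥ 1`. -/
theorem integral_cauchyT_dbar₂ {D₂ : Set ℂ} (hA : Integrable A) (hA0 : ∀ z, 1 ≤ ‖z.1‖ → A z = 0)
    (hw : ∀ ψ, IsTest (disc ×ˢ D₂) ψ → ∫ z, A z * dbar₂ ψ z = 0)
    (hχ : IsTest (disc ×ˢ D₂) χ) : ∫ w, cauchyT A w * dbar₂ χ w = 0 := by
  obtain ⟨hs, hc, hsub⟩ := hχ
  obtain ⟨B, R, hB, hR⟩ := exists_bound_of_hasCompactSupport (continuous_dbar₂ hs)
    (hasCompactSupport_dbar₂ hc)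
  have hint := integrable_mul_cauchyPot hA hA0 (continuous_dbar₂ hs).measurable hB hR
  rw [integral_cauchyT_mul hA hA0 (continuous_dbar₂ hs).measurable hB hR]
  have hκs : ∀ n, ContDiff ℝ ((⊤ : ℕ∞) : WithTop ℕ∞) fun ζ : ℂ => ((cutoff n ζ : ℝ) : ℂ) :=
    fun n => Complex.ofRealCLM.contDiff.comp (cutoff n).contDiff
  have hX := contDiff_cauchyPot hs hc
  have hprod : ∀ n, ContDiff ℝ ((⊤ : ℕ∞) : WithTop ℕ∞)
      fun z : ℂ × ℂ => ((cutoff n z.1 : ℝ) : ℂ) * cauchyPot χ z :=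
    fun n => ((hκs n).comp contDiff_fst).mul hX
  have hd : ∀ n z, dbar₂ (fun z : ℂ × ℂ => ((cutoff n z.1 : ℝ) : ℂ) * cauchyPot χ z) z =
      ((cutoff n z.1 : ℝ) : ℂ) * cauchyPot (dbar₂ χ) z := fun n z => by
    have hκ : ContDiff ℝ ((⊤ : ℕ∞) : WithTop ℕ∞) fun z : ℂ × ℂ => ((cutoff n z.1 : ℝ) : ℂ) :=
      (hκs n).comp contDiff_fst
    rw [dbar₂_mul (hκ.differentiable (by simp) z) (hX.differentiable (by simp) z), dbar₂_cauchyPot hs hc]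
    have := dbar₂_comp_fst (z := z) ((hκs n).differentiable (by simp) z.1)
    rw [this]
    ring
  have hsupp : ∀ n, Function.support (fun z : ℂ × ℂ => ((cutoff n z.1 : ℝ) : ℂ) * cauchyPot χ z) ⊆
      closedBall 0 (cutoff n).rOut ×ˢ (Prod.snd '' tsupport χ) := fun n z hz => by
    have h1 := left_ne_zero_of_mul hz
    have h2 := right_ne_zero_of_mul hz
    refine ⟨?_, ?_⟩
    · refine ball_subset_closedBall ?_
      rw [← (cutoff n).support_eq]
      exact fun h => h1 (by simp [h])
    · by_contra hn
      refine h2 ?_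
      unfold cauchyPot
      refine integral_eq_zero_of_ae (Eventually.of_forall fun t => ?_)
      have : χ (z.1 - t, z.2) = 0 :=
        image_eq_zero_of_notMem_tsupport fun hm => hn ⟨_, hm, rfl⟩
      simp [this]
  have hK : ∀ n, IsCompact (closedBall (0 : ℂ) (cutoff n).rOut ×ˢ (Prod.snd '' tsupport χ)) :=
    fun n => (isCompact_closedBall _ _).prod (hc.isCompact.image continuous_snd)
  have htest : ∀ n, IsTest (disc ×ˢ D₂)
      fun z : ℂ × ℂ => ((cutoff n z.1 : ℝ) : ℂ) * cauchyPot χ z := fun n => by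
    refine ⟨hprod n, HasCompactSupport.of_support_subset_isCompact (hK n) (hsupp n), ?_⟩
    refine (closure_minimal (hsupp n) (hK n).isClosed).trans (prod_mono (fun ζ hζ => ?_) ?_)
    · rw [mem_closedBall_zero_iff] at hζ
      refine hζ.trans_lt ?_
      have : (0 : ℝ) < 1 / (n + 3) := by positivity
      change (1 : ℝ) - 1 / (n + 3) < 1
      linarith
    · rintro _ ⟨z, hz, rfl⟩
      exact (hsub hz).2
  have hz : ∀ n, ∫ z, A z * (((cutoff n z.1 : ℝ) : ℂ) * cauchyPot (dbar₂ χ) z) = 0 := fun n => by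
    have := hw _ (htest n)
    simpa only [hd] using this
  have hlim : Tendsto (fun n => ∫ z, A z * (((cutoff n z.1 : ℝ) : ℂ) * cauchyPot (dbar₂ χ) z))
      atTop (𝓝 (∫ z, A z * cauchyPot (dbar₂ χ) z)) := by
    refine tendsto_integral_of_dominated_convergence _ (fun n => ?_) hint.norm
      (fun n => Eventually.of_forall fun z => ?_) (Eventually.of_forall fun z => ?_)
    · have h1 : AEStronglyMeasurable (fun z : ℂ × ℂ => ((cutoff n z.1 : ℝ) : ℂ)) volume :=
        ((hκs n).continuous.comp continuous_fst).aestronglyMeasurable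
      refine (h1.mul hint.aestronglyMeasurable).congr (Eventually.of_forall fun z => ?_)
      simp only [Pi.mul_apply]
      ring
    · rw [mul_left_comm, norm_mul]
      refine mul_le_of_le_one_left (norm_nonneg _) ?_
      rw [Complex.norm_real, Real.norm_of_nonneg (cutoff n).nonneg]
      exact (cutoff n).le_one
    · by_cases h : 1 ≤ ‖z.1‖
      · simp [hA0 z h]
      · have := ((tendsto_cutoff (not_le.1 h)).mul_const (cauchyPot (dbar₂ χ) z)).const_mul (A z)
        simpa using this
  simp only [hz] at hlim
  exact (tendsto_nhds_unique tendsto_const_nhds hlim).symm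

end Kernel

/-! ### The change of variables between the Hartogs triangle and the product. -/

theorem isOpen_disc : IsOpen disc := isOpen_lt continuous_norm continuous_const

theorem isOpen_puncturedDisc : IsOpen puncturedDisc :=
  (isOpen_lt continuous_const continuous_norm).inter (isOpen_lt continuous_norm continuous_const)

theorem isOpen_hartogs : IsOpen hartogs :=
  (isOpen_lt continuous_fst.norm continuous_snd.norm).inter
    (isOpen_lt continuous_snd.norm continuous_const)

theorem isOpen_disc_prod : IsOpen (disc ×ˢ puncturedDisc) :=
  isOpen_disc.prod isOpen_puncturedDisc

theorem ne_zero_of_mem_puncturedDisc {c : ℂ} (hc : c ∈ puncturedDisc) : c ≠ 0 :=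
  norm_pos_iff.1 hc.1

theorem measurable_phi : Measurable phi := by
  unfold phi
  fun_prop

theorem contDiff_phiInv {n : WithTop ℕ∞} : ContDiff ℝ n phiInv :=
  (contDiff_fst.mul contDiff_snd).prodMk contDiff_snd

theorem phi_phiInv {w : ℂ × ℂ} (hw : w.2 ≠ 0) : phi (phiInv w) = w := by
  simp [phi, phiInv, hw]

theorem phiInv_phi {z : ℂ × ℂ} (hz : z.2 ≠ 0) : phiInv (phi z) = z := by
  simp [phi, phiInv, hz]

theorem phiInv_mem_hartogs {w : ℂ × ℂ} :
    phiInv w ∈ hartogs ↔ w ∈ disc ×ˢ puncturedDisc := by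
  simp only [hartogs, phiInv, disc, puncturedDisc, mem_ofPred_eq, mem_prod, norm_mul]
  constructor
  · rintro ⟨h1, h2⟩
    have h3 : 0 < ‖w.2‖ := by
      by_contra! h
      have : ‖w.2‖ = 0 := le_antisymm h (norm_nonneg _)
      simp [this] at h1
    exact ⟨by nlinarith, h3, h2⟩
  · rintro ⟨h1, h2, h3⟩
    exact ⟨by nlinarith, h3⟩

theorem snd_ne_zero_of_mem_hartogs {z : ℂ × ℂ} (hz : z ∈ hartogs) : z.2 ≠ 0 :=
  norm_pos_iff.1 ((norm_nonneg _).trans_lt hz.1)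

theorem phi_mem {z : ℂ × ℂ} (hz : z ∈ hartogs) : phi z ∈ disc ×ˢ puncturedDisc := by
  rw [← phiInv_mem_hartogs, phiInv_phi (snd_ne_zero_of_mem_hartogs hz)]
  exact hz

/-- The measure on the product domain corresponding to Lebesgue measure on the Hartogs triangle. -/
def weighted : Measure (ℂ × ℂ) :=
  (volume.restrict (disc ×ˢ puncturedDisc)).withDensity fun w => ((‖w.2‖₊ ^ 2 : ℝ≥0) : ℝ≥0∞)

theorem measurable_density : Measurable fun w : ℂ × ℂ => ‖w.2‖₊ ^ 2 := by fun_prop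

/-- Multiplication by `c`, as a real linear map, has determinant `|c|²`. -/
theorem volume_preimage_mul_right {c : ℂ} (hc : c ≠ 0) (s : Set ℂ) :
    ((‖c‖₊ ^ 2 : ℝ≥0) : ℝ≥0∞) * volume ((· * c) ⁻¹' s) = volume s := by
  have hn : ‖c‖ ≠ 0 := norm_ne_zero_iff.2 hc
  have hdet : LinearMap.det (Algebra.lmul ℝ ℂ c) = ‖c‖ ^ 2 := by
    rw [← Algebra.norm_apply, Algebra.norm_complex_apply, Complex.normSq_eq_norm_sq]
  have h := Measure.addHaar_preimage_linearMap (volume : Measure ℂ) (f := Algebra.lmul ℝ ℂ c)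
    (by rw [hdet]; positivity) s
  have hfun : (⇑(Algebra.lmul ℝ ℂ c) : ℂ → ℂ) = (· * c) := by
    ext z
    simp [mul_comm]
  rw [hfun, hdet] at h
  rw [h, ← mul_assoc, abs_of_nonneg (by positivity), ← ENNReal.ofReal_coe_nnreal,
    ← ENNReal.ofReal_mul (by positivity)]
  have : ((‖c‖₊ ^ 2 : ℝ≥0) : ℝ) * (‖c‖ ^ 2)⁻¹ = 1 := by
    push_cast
    exact mul_inv_cancel₀ (by positivity)
  rw [this, ENNReal.ofReal_one, one_mul]

/-- On the slice `w₂ = c` the map is multiplication by `c`, so Tonelli reduces the claim to one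
complex variable. -/
theorem measurePreserving_phiInv :
    MeasurePreserving phiInv weighted (volume.restrict hartogs) := by
  have hm : Measurable phiInv := (contDiff_phiInv (n := 0)).continuous.measurable
  refine ⟨hm, Measure.ext fun s hs => ?_⟩
  have hms : MeasurableSet (phiInv ⁻¹' (s ∩ hartogs)) := hm (hs.inter isOpen_hartogs.measurableSet)
  have hset : phiInv ⁻¹' s ∩ disc ×ˢ puncturedDisc = phiInv ⁻¹' (s ∩ hartogs) := by
    ext w
    simp only [mem_inter_iff, mem_preimage, phiInv_mem_hartogs]
  rw [Measure.map_apply hm hs, weighted, withDensity_apply _ (hm hs),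
    Measure.restrict_restrict (hm hs), hset, Measure.restrict_apply hs,
    ← lintegral_indicator hms, Measure.volume_eq_prod,
    Measure.prod_apply_symm (hs.inter isOpen_hartogs.measurableSet),
    lintegral_prod_symm _ ((measurable_density.coe_nnreal_ennreal.indicator hms).aemeasurable)]
  refine lintegral_congr fun c => ?_
  -- The slice `c = 0` contributes nothing: it misses the Hartogs triangle, and the density vanishes
  -- there.
  by_cases hc : c = 0
  · have h1 : (fun x : ℂ => (x, c)) ⁻¹' (s ∩ hartogs) = ∅ := by
      ext x
      simp only [mem_preimage, mem_inter_iff, mem_empty_iff_false, iff_false, not_and]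
      exact fun _ h => snd_ne_zero_of_mem_hartogs h hc
    rw [h1, measure_empty, ← lintegral_zero]
    refine lintegral_congr fun x => ?_
    by_cases h : (x, c) ∈ phiInv ⁻¹' (s ∩ hartogs)
    · rw [indicator_of_mem h]
      simp [hc]
    · rw [indicator_of_notMem h]
  · have hmc : MeasurableSet ((· * c) ⁻¹' ((fun x : ℂ => (x, c)) ⁻¹' (s ∩ hartogs))) :=
      (measurable_id.mul_const c) (measurable_prodMk_right (hs.inter isOpen_hartogs.measurableSet))
    rw [← volume_preimage_mul_right hc, ← lintegral_indicator_const hmc]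
    rfl

theorem ae_weighted_iff {P : ℂ × ℂ → Prop} :
    (∀ᵐ w ∂weighted, P w) ↔ ∀ᵐ w ∂(volume.restrict (disc ×ˢ puncturedDisc)), P w := by
  rw [weighted, ae_withDensity_iff measurable_density.coe_nnreal_ennreal]
  refine ⟨fun h => ?_, fun h => h.mono fun w hw _ => hw⟩
  filter_upwards [h, ae_restrict_mem isOpen_disc_prod.measurableSet] with w hw hmem
  refine hw ?_
  have := ne_zero_of_mem_puncturedDisc hmem.2
  simpa using this

theorem measurePreserving_phi : MeasurePreserving phi (volume.restrict hartogs) weighted := by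
  refine ⟨measurable_phi, ?_⟩
  rw [← measurePreserving_phiInv.map_eq,
    Measure.map_map measurable_phi measurePreserving_phiInv.measurable]
  have : phi ∘ phiInv =ᵐ[weighted] id := by
    refine ae_weighted_iff.2 ?_
    filter_upwards [ae_restrict_mem isOpen_disc_prod.measurableSet] with w hw
    exact phi_phiInv (ne_zero_of_mem_puncturedDisc hw.2)
  rw [Measure.map_congr this, Measure.map_id]

theorem volume_hartogs_lt_top : volume hartogs < ∞ := by
  refine (measure_mono (t := ball 0 1) fun z hz => ?_).trans_lt measure_ball_lt_top
  rw [mem_ball_zero_iff, Prod.norm_def, max_lt_iff]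
  exact ⟨hz.1.trans hz.2, hz.2⟩

instance : IsFiniteMeasure (volume.restrict hartogs) :=
  ⟨by rw [Measure.restrict_apply_univ]; exact volume_hartogs_lt_top⟩

instance : IsFiniteMeasure weighted := by
  rw [← measurePreserving_phi.map_eq]
  infer_instance

theorem setIntegral_hartogs {g : ℂ × ℂ → ℂ}
    (hg : AEStronglyMeasurable g (volume.restrict hartogs)) :
    ∫ z in hartogs, g z =
      ∫ w in disc ×ˢ puncturedDisc, (w.2 * conj w.2) * g (phiInv w) := by
  rw [← measurePreserving_phiInv.map_eq, integral_map
    measurePreserving_phiInv.measurable.aemeasurable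
    (by rwa [measurePreserving_phiInv.map_eq]), weighted,
    integral_withDensity_eq_integral_smul measurable_density]
  congr with w
  rw [Complex.mul_conj, Complex.normSq_eq_norm_sq, NNReal.smul_def, Complex.real_smul]
  simp

theorem integrable_weighted_iff {g : ℂ × ℂ → ℂ} :
    Integrable g weighted ↔
      IntegrableOn (fun w => (w.2 * conj w.2) * g w) (disc ×ˢ puncturedDisc) := by
  rw [weighted, integrable_withDensity_iff_integrable_smul measurable_density]
  refine integrable_congr (Eventually.of_forall fun w => ?_)
  beta_reduce
  rw [Complex.mul_conj, Complex.normSq_eq_norm_sq, NNReal.smul_def, Complex.real_smul]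
  simp

/-! ### Pull-back of Cauchy–Riemann operators and test functions. -/

theorem fderiv_phiInv (w : ℂ × ℂ) (v : ℂ × ℂ) :
    fderiv ℝ phiInv w v = (w.1 * v.2 + v.1 * w.2, v.2) := by
  have h : HasFDerivAt phiInv ((w.1 • ContinuousLinearMap.snd ℝ ℂ ℂ +
      w.2 • ContinuousLinearMap.fst ℝ ℂ ℂ).prod (ContinuousLinearMap.snd ℝ ℂ ℂ)) w :=
    (hasFDerivAt_fst.mul hasFDerivAt_snd).prodMk hasFDerivAt_snd
  rw [h.fderiv]
  simp [mul_comm]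

/-- The left side isolates the conjugate-linear part of `L`, which turns a factor `c` into `c̄`.
This is the chain rule for `∂̄` under a holomorphic map. -/
theorem dbar_clm (L : ℂ × ℂ →L[ℝ] ℂ) (c : ℂ) :
    L (c, 0) + Complex.I * L (c * Complex.I, 0) =
      conj c * (L (1, 0) + Complex.I * L (Complex.I, 0)) := by
  have h1 : ((c, 0) : ℂ × ℂ) = c.re • (1, 0) + c.im • (Complex.I, 0) := by
    simp [Complex.real_smul, Complex.re_add_im]
  have h2 : ((c * Complex.I, 0) : ℂ × ℂ) = c.re • (Complex.I, 0) + (-c.im) • (1, 0) := by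
    simp only [Prod.smul_mk, Complex.real_smul, smul_zero, Prod.mk_add_mk, add_zero]
    congr 1
    nth_rewrite 1 [← Complex.re_add_im c]
    push_cast
    linear_combination (c.im : ℂ) * Complex.I_mul_I
  have h3 : conj c = c.re - c.im * Complex.I := by
    apply Complex.ext <;> simp
  rw [h1, h2, map_add, map_add, map_smul, map_smul, map_smul, map_smul, h3]
  simp only [Complex.real_smul]
  push_cast
  linear_combination (c.im * L (Complex.I, 0)) * Complex.I_mul_I

theorem fderiv_comp_phiInv {ψ : ℂ × ℂ → ℂ} {w : ℂ × ℂ} (hψ : DifferentiableAt ℝ ψ (phiInv w))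
    (v : ℂ × ℂ) : fderiv ℝ (ψ ∘ phiInv) w v =
      fderiv ℝ ψ (phiInv w) (w.1 * v.2 + v.1 * w.2, v.2) := by
  rw [fderiv_comp w hψ ((contDiff_phiInv (n := 1)).differentiable one_ne_zero w),
    ContinuousLinearMap.comp_apply, fderiv_phiInv]

theorem dbar₁_comp_phiInv {ψ : ℂ × ℂ → ℂ} {w : ℂ × ℂ}
    (hψ : DifferentiableAt ℝ ψ (phiInv w)) :
    dbar₁ (ψ ∘ phiInv) w = conj w.2 * dbar₁ ψ (phiInv w) := by
  simp only [dbar₁, fderiv_comp_phiInv hψ]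
  have := dbar_clm (fderiv ℝ ψ (phiInv w)) w.2
  simp only [mul_zero, zero_add, one_mul, mul_comm Complex.I w.2]
  linear_combination (1 / 2) * this

theorem dbar₂_comp_phiInv {ψ : ℂ × ℂ → ℂ} {w : ℂ × ℂ}
    (hψ : DifferentiableAt ℝ ψ (phiInv w)) :
    dbar₂ (ψ ∘ phiInv) w = conj w.1 * dbar₁ ψ (phiInv w) + dbar₂ ψ (phiInv w) := by
  simp only [dbar₂, dbar₁, fderiv_comp_phiInv hψ]
  have := dbar_clm (fderiv ℝ ψ (phiInv w)) w.1
  have h : ∀ a b : ℂ, fderiv ℝ ψ (phiInv w) (a, b) =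
      fderiv ℝ ψ (phiInv w) (a, 0) + fderiv ℝ ψ (phiInv w) (0, b) := fun a b => by
    rw [← map_add]
    simp
  simp only [mul_one, zero_mul, add_zero]
  rw [h w.1 1, h (w.1 * Complex.I) Complex.I]
  linear_combination (1 / 2) * this

theorem IsTest.comp_phiInv {ψ : ℂ × ℂ → ℂ} (hψ : IsTest hartogs ψ) :
    IsTest (disc ×ˢ puncturedDisc) (ψ ∘ phiInv) := by
  obtain ⟨hs, hc, hsub⟩ := hψ
  have hcont : ContinuousOn phi (tsupport ψ) := by
    refine ContinuousOn.prodMk (continuousOn_fst.div continuousOn_snd fun z hz => ?_)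
      continuousOn_snd
    exact snd_ne_zero_of_mem_hartogs (hsub hz)
  have hK : IsCompact (phi '' tsupport ψ) := hc.isCompact.image_of_continuousOn hcont
  have hsupp : Function.support (ψ ∘ phiInv) ⊆ phi '' tsupport ψ := fun w hw => by
    have hm : phiInv w ∈ tsupport ψ := subset_tsupport _ hw
    exact ⟨_, hm, phi_phiInv (snd_ne_zero_of_mem_hartogs (z := phiInv w) (hsub hm))⟩
  refine ⟨hs.comp contDiff_phiInv, HasCompactSupport.of_support_subset_isCompact hK hsupp,
    (closure_minimal hsupp hK.isClosed).trans ?_⟩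
  rintro _ ⟨z, hz, rfl⟩
  exact phi_mem (hsub hz)

/-- The compact support projects to a compact set missing `0`. Hence `χ ∘ phi` and `z₂⁻¹ χ` are
smooth across `z₂ = 0`, where division takes its default value. -/
theorem IsTest.eventually_snd {χ : ℂ × ℂ → ℂ} (hχ : IsTest (disc ×ˢ puncturedDisc) χ) :
    ∀ᶠ c in 𝓝 (0 : ℂ), ∀ a, χ (a, c) = 0 := by
  obtain ⟨-, hc, hsub⟩ := hχ
  have hK := (hc.isCompact.image continuous_snd).isClosed
  have h0 : (0 : ℂ) ∉ Prod.snd '' tsupport χ := by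
    rintro ⟨z, hz, h⟩
    exact ne_zero_of_mem_puncturedDisc (hsub hz).2 h
  filter_upwards [hK.isOpen_compl.mem_nhds h0] with c hc' a
  exact image_eq_zero_of_notMem_tsupport fun h => hc' ⟨_, h, rfl⟩

theorem IsTest.comp_phi {χ : ℂ × ℂ → ℂ} (hχ : IsTest (disc ×ˢ puncturedDisc) χ) :
    IsTest hartogs (χ ∘ phi) := by
  have hev := hχ.eventually_snd
  obtain ⟨hs, hc, hsub⟩ := hχ
  have hK : IsCompact (phiInv '' tsupport χ) :=
    hc.isCompact.image (contDiff_phiInv (n := 0)).continuous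
  have hsupp : Function.support (χ ∘ phi) ⊆ phiInv '' tsupport χ := fun z hz => by
    have hm : phi z ∈ tsupport χ := subset_tsupport _ hz
    exact ⟨_, hm, phiInv_phi (ne_zero_of_mem_puncturedDisc (hsub hm).2)⟩
  refine ⟨contDiff_iff_contDiffAt.2 fun z => ?_,
    HasCompactSupport.of_support_subset_isCompact hK hsupp,
    (closure_minimal hsupp hK.isClosed).trans ?_⟩
  · by_cases hz : z.2 = 0
    · have h0 : χ ∘ phi =ᶠ[𝓝 z] fun _ => 0 := by
        have : Tendsto (fun w : ℂ × ℂ => w.2) (𝓝 z) (𝓝 0) := by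
          simpa [hz] using continuous_snd.tendsto z
        filter_upwards [this.eventually hev] with w hw
        exact hw _
      exact contDiffAt_const.congr_of_eventuallyEq h0
    · refine hs.contDiffAt.comp z ?_
      refine ContDiffAt.prodMk ?_ contDiffAt_snd
      exact contDiffAt_fst.mul (contDiffAt_snd.inv hz)
  · rintro _ ⟨w, hw, rfl⟩
    exact phiInv_mem_hartogs.2 (hsub hw)

theorem IsTest.mul_left {U : Set (ℂ × ℂ)} {χ g : ℂ × ℂ → ℂ} (hχ : IsTest U χ)
    (hg : ContDiff ℝ ((⊤ : ℕ∞) : WithTop ℕ∞) g) : IsTest U fun z => g z * χ z :=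
  ⟨hg.mul hχ.1, hχ.2.1.mul_left, (tsupport_mul_subset_right (f := g)).trans hχ.2.2⟩

theorem IsTest.inv_snd_mul {χ : ℂ × ℂ → ℂ} (hχ : IsTest (disc ×ˢ puncturedDisc) χ) :
    IsTest (disc ×ˢ puncturedDisc) fun z => z.2⁻¹ * χ z := by
  refine ⟨contDiff_iff_contDiffAt.2 fun z => ?_, hχ.2.1.mul_left,
    (tsupport_mul_subset_right (f := fun z : ℂ × ℂ => z.2⁻¹)).trans hχ.2.2⟩
  by_cases hz : z.2 = 0
  · have h0 : (fun z : ℂ × ℂ => z.2⁻¹ * χ z) =ᶠ[𝓝 z] fun _ => 0 := by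
      have : Tendsto (fun w : ℂ × ℂ => w.2) (𝓝 z) (𝓝 0) := by
        simpa [hz] using continuous_snd.tendsto z
      filter_upwards [this.eventually hχ.eventually_snd] with w hw
      rw [show χ w = 0 from hw w.1, mul_zero]
    exact contDiffAt_const.congr_of_eventuallyEq h0
  · exact (contDiffAt_snd.inv hz).mul hχ.1.contDiffAt

/-! ### Schur's test on slices and the weighted `L^p` estimate. -/

theorem disc_eq_ball : disc = ball (0 : ℂ) 1 := by
  ext z
  simp [disc]

theorem lintegral_disc_enorm_inv_sub_le {x : ℂ} (hx : x ∈ disc) :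
    ∫⁻ ζ in disc, ‖(ζ - x)⁻¹‖ₑ ≤ kernelMass 2 := by
  rw [disc_eq_ball]
  have := lintegral_enorm_inv_sub_le (le_of_lt hx : ‖x‖ ≤ 1) 1
  norm_num at this
  simpa using this

/-- Hölder for the measure `|ζ - x|⁻¹ dA` on the disc, of mass at most `kernelMass 2`; the exponent
is `p (1 - 1/p) = p - 1`. -/
theorem rpow_lintegral_cauchy_le {h : ℂ → ℂ} (hh : Measurable h) {p : ℝ≥0∞} (hp : 1 ≤ p)
    (hp' : p ≠ ∞) {x : ℂ} (hx : x ∈ disc) :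
    (∫⁻ ζ in disc, ‖h ζ‖ₑ * ‖(ζ - x)⁻¹‖ₑ) ^ p.toReal ≤
      kernelMass 2 ^ (p.toReal - 1) * ∫⁻ ζ in disc, ‖h ζ‖ₑ ^ p.toReal * ‖(ζ - x)⁻¹‖ₑ := by
  have hp0 : p ≠ 0 := (zero_lt_one.trans_le hp).ne'
  have hq : 1 ≤ p.toReal := by
    simpa using ENNReal.toReal_mono hp' hp
  have hq0 : 0 < p.toReal := zero_lt_one.trans_le hq
  have hk : Measurable fun ζ : ℂ => ‖(ζ - x)⁻¹‖ₑ := by fun_prop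
  set ν := (volume.restrict disc).withDensity fun ζ : ℂ => ‖(ζ - x)⁻¹‖ₑ with hν
  have hνu : ν univ ≤ kernelMass 2 := by
    rw [hν, withDensity_apply _ MeasurableSet.univ, setLIntegral_univ]
    exact lintegral_disc_enorm_inv_sub_le hx
  have h1 : ∀ g : ℂ → ℝ≥0∞, Measurable g → ∫⁻ ζ, g ζ ∂ν = ∫⁻ ζ in disc, g ζ * ‖(ζ - x)⁻¹‖ₑ :=
    fun g hg => by
      rw [hν, lintegral_withDensity_eq_lintegral_mul _ hk hg]
      simp only [Pi.mul_apply, mul_comm]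
  rw [← h1 _ hh.enorm, ← h1 _ (hh.enorm.pow_const _), ← eLpNorm_one_eq_lintegral_enorm]
  have h2 := eLpNorm_le_eLpNorm_mul_rpow_measure_univ (μ := ν) hp hh.aestronglyMeasurable
  calc _ ≤ (eLpNorm h p ν * ν univ ^ (1 / (1 : ℝ≥0∞).toReal - 1 / p.toReal)) ^ p.toReal :=
        ENNReal.rpow_le_rpow h2 hq0.le
    _ = (∫⁻ ζ, ‖h ζ‖ₑ ^ p.toReal ∂ν) * ν univ ^ (p.toReal - 1) := by
        rw [ENNReal.mul_rpow_of_nonneg _ _ hq0.le, eLpNorm_eq_lintegral_rpow_enorm_toReal hp0 hp',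
          ← ENNReal.rpow_mul, ← ENNReal.rpow_mul, one_div_mul_cancel hq0.ne', ENNReal.rpow_one]
        congr 2
        rw [ENNReal.toReal_one]
        field_simp
    _ ≤ _ := by
        rw [mul_comm]
        gcongr

/-- The Schur test for the Cauchy kernel on the disc. -/
theorem lintegral_rpow_cauchy_le {h : ℂ → ℂ} (hh : Measurable h) {p : ℝ≥0∞} (hp : 1 ≤ p)
    (hp' : p ≠ ∞) :
    ∫⁻ x in disc, (∫⁻ ζ in disc, ‖h ζ‖ₑ * ‖(ζ - x)⁻¹‖ₑ) ^ p.toReal ≤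
      kernelMass 2 ^ p.toReal * ∫⁻ ζ in disc, ‖h ζ‖ₑ ^ p.toReal := by
  have hq : 1 ≤ p.toReal := by
    simpa using ENNReal.toReal_mono hp' hp
  have hK := (kernelMass_lt_top 2).ne
  have hm : Measurable fun q : ℂ × ℂ => ‖h q.2‖ₑ ^ p.toReal * ‖(q.2 - q.1)⁻¹‖ₑ := by fun_prop
  calc _ ≤ ∫⁻ x in disc, kernelMass 2 ^ (p.toReal - 1) *
        ∫⁻ ζ in disc, ‖h ζ‖ₑ ^ p.toReal * ‖(ζ - x)⁻¹‖ₑ :=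
        setLIntegral_mono' isOpen_disc.measurableSet fun x hx =>
          rpow_lintegral_cauchy_le hh hp hp' hx
    _ = kernelMass 2 ^ (p.toReal - 1) *
        ∫⁻ ζ in disc, ∫⁻ x in disc, ‖h ζ‖ₑ ^ p.toReal * ‖(ζ - x)⁻¹‖ₑ := by
        rw [lintegral_const_mul' _ _ (ENNReal.rpow_ne_top_of_nonneg (by linarith) hK),
          lintegral_lintegral_swap hm.aemeasurable]
    -- After Tonelli, the symmetry of `|ζ - x|` bounds the integral in `x` by the same mass, which
    -- supplies the missing power.
    _ ≤ kernelMass 2 ^ (p.toReal - 1) *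
        ∫⁻ ζ in disc, ‖h ζ‖ₑ ^ p.toReal * kernelMass 2 := by
        refine mul_le_mul_right (setLIntegral_mono' isOpen_disc.measurableSet fun ζ hζ => ?_) _
        rw [lintegral_const_mul' _ _ (ENNReal.rpow_ne_top_of_nonneg (by linarith) enorm_ne_top)]
        gcongr
        refine le_trans (le_of_eq ?_) (lintegral_disc_enorm_inv_sub_le hζ)
        refine lintegral_congr fun x => ?_
        rw [← neg_sub x ζ, inv_neg, enorm_neg]
    _ = _ := by
        rw [lintegral_mul_const' _ _ hK, mul_comm (∫⁻ ζ in disc, _), ← mul_assoc]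
        congr 1
        nth_rewrite 2 [← ENNReal.rpow_one (kernelMass 2)]
        rw [← ENNReal.rpow_add_of_nonneg _ _ (by linarith) zero_le_one, sub_add_cancel]

theorem lintegral_weighted {g : ℂ × ℂ → ℝ≥0∞} (hg : Measurable g) :
    ∫⁻ w, g w ∂weighted =
      ∫⁻ c in puncturedDisc, ((‖c‖₊ ^ 2 : ℝ≥0) : ℝ≥0∞) * ∫⁻ x in disc, g (x, c) := by
  have hd := measurable_density.coe_nnreal_ennreal
  rw [weighted, lintegral_withDensity_eq_lintegral_mul _ hd hg,
    Measure.volume_eq_prod, ← Measure.prod_restrict, lintegral_prod_symm _ (hd.mul hg).aemeasurable]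
  refine lintegral_congr fun c => ?_
  exact lintegral_const_mul (((‖c‖₊ ^ 2 : ℝ≥0) : ℝ≥0∞)) (hg.comp measurable_prodMk_right)

theorem stronglyMeasurable_cauchyT {F : ℂ × ℂ → ℂ} (hF : Measurable F) :
    StronglyMeasurable (cauchyT F) := by
  have : Measurable fun q : (ℂ × ℂ) × ℂ => F (q.2, q.1.2) * (Real.pi * (q.1.1 - q.2))⁻¹ := by
    fun_prop
  exact this.stronglyMeasurable.integral_prod_right'

theorem enorm_cauchyT_le {a : ℂ × ℂ → ℂ} (ha0 : ∀ z, z ∉ disc ×ˢ puncturedDisc → a z = 0)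
    {w : ℂ × ℂ} (hw : w.2 ∈ puncturedDisc) :
    ‖cauchyT (fun z => conj z.2 * a z) w‖ₑ ≤
      ∫⁻ ζ in disc, ‖a (ζ, w.2)‖ₑ * ‖(ζ - w.1)⁻¹‖ₑ := by
  unfold cauchyT
  refine (enorm_integral_le_lintegral_enorm _).trans ?_
  rw [← lintegral_indicator isOpen_disc.measurableSet]
  refine lintegral_mono fun ζ => ?_
  by_cases hζ : ζ ∈ disc
  · rw [indicator_of_mem hζ, ← neg_sub ζ w.1, mul_neg, inv_neg, mul_inv]
    rw [enorm_mul, enorm_mul, enorm_neg, enorm_mul]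
    have h1 : ‖conj w.2‖ₑ ≤ 1 := by
      rw [← ofReal_norm, RCLike.norm_conj, ENNReal.ofReal_le_one]
      exact hw.2.le
    have h2 : ‖(Real.pi : ℂ)⁻¹‖ₑ ≤ 1 := by
      rw [← ofReal_norm, norm_inv, Complex.norm_real, Real.norm_of_nonneg Real.pi_pos.le]
      rw [ENNReal.ofReal_le_one]
      exact inv_le_one_of_one_le₀ (by linarith [Real.pi_gt_three])
    calc _ ≤ (1 * ‖a (ζ, w.2)‖ₑ) * (1 * ‖(ζ - w.1)⁻¹‖ₑ) := by gcongr
      _ = _ := by rw [one_mul, one_mul]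
  · have : a (ζ, w.2) = 0 := ha0 _ fun h => hζ h.1
    simp [this]

/-- The weight `|w₂|²` is a constant on each slice, so Schur's test applies slice by slice with a
constant independent of the slice. -/
theorem eLpNorm_cauchyT_le {a : ℂ × ℂ → ℂ} (ha : Measurable a)
    (ha0 : ∀ z, z ∉ disc ×ˢ puncturedDisc → a z = 0) {p : ℝ≥0∞} (hp : 1 ≤ p) (hp' : p ≠ ∞) :
    eLpNorm (cauchyT fun z => conj z.2 * a z) p weighted ≤
      kernelMass 2 * eLpNorm a p weighted := by
  have hp0 : p ≠ 0 := (zero_lt_one.trans_le hp).ne'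
  have hq : 1 ≤ p.toReal := by
    simpa using ENNReal.toReal_mono hp' hp
  have hq0 : 0 < p.toReal := zero_lt_one.trans_le hq
  have hFm : Measurable fun z : ℂ × ℂ => conj z.2 * a z :=
    (Complex.continuous_conj.measurable.comp measurable_snd).mul ha
  have hF := (stronglyMeasurable_cauchyT hFm).measurable
  rw [eLpNorm_eq_lintegral_rpow_enorm_toReal hp0 hp', eLpNorm_eq_lintegral_rpow_enorm_toReal hp0 hp',
    one_div, ENNReal.rpow_inv_le_iff hq0, ENNReal.mul_rpow_of_nonneg _ _ hq0.le,
    ENNReal.rpow_inv_rpow hq0.ne', lintegral_weighted (hF.enorm.pow_const _),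
    lintegral_weighted (ha.enorm.pow_const _),
    ← lintegral_const_mul' _ _ (ENNReal.rpow_ne_top_of_nonneg hq0.le (kernelMass_lt_top 2).ne)]
  refine setLIntegral_mono' isOpen_puncturedDisc.measurableSet fun c hc => ?_
  rw [mul_left_comm]
  refine mul_le_mul_right ?_ _
  refine le_trans ?_ (lintegral_rpow_cauchy_le (ha.comp measurable_prodMk_right) hp hp')
  exact lintegral_mono fun x => ENNReal.rpow_le_rpow (enorm_cauchyT_le ha0 (w := (x, c)) hc) hq0.le

/-! ### Representatives, integrability and uniqueness of `𝒟 f`. -/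

theorem aestronglyMeasurable_weighted_iff {g : ℂ × ℂ → ℂ} :
    AEStronglyMeasurable g weighted ↔
      AEStronglyMeasurable g (volume.restrict (disc ×ˢ puncturedDisc)) := by
  have h : volume.restrict (disc ×ˢ puncturedDisc) ≪ weighted :=
    Measure.AbsolutelyContinuous.mk fun s _ hs => by
      have := ae_weighted_iff (P := fun w => w ∉ s)
      rw [← compl_mem_ae_iff] at hs ⊢
      exact this.1 hs
  exact ⟨fun hg => hg.mono_ac h, fun hg => hg.mono_ac (withDensity_absolutelyContinuous _ _)⟩

/-- A Borel representative has measurable slices, and its vanishing off the domain allows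
integration over the whole space. -/
theorem exists_measurable_representative {g : ℂ × ℂ → ℂ} (hg : AEStronglyMeasurable g weighted) :
    ∃ a : ℂ × ℂ → ℂ, Measurable a ∧ (∀ z, z ∉ disc ×ˢ puncturedDisc → a z = 0) ∧
      a =ᵐ[volume.restrict (disc ×ˢ puncturedDisc)] g := by
  rw [aestronglyMeasurable_weighted_iff] at hg
  refine ⟨(disc ×ˢ puncturedDisc).indicator (hg.mk g),
    hg.stronglyMeasurable_mk.measurable.indicator isOpen_disc_prod.measurableSet,
    fun z hz => indicator_of_notMem hz _, ?_⟩
  exact (indicator_ae_eq_restrict isOpen_disc_prod.measurableSet).trans hg.ae_eq_mk.symm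

theorem integrable_mul_of_continuous {A g : ℂ × ℂ → ℂ} (hA : Integrable A)
    (hA0 : ∀ z, z ∉ disc ×ˢ puncturedDisc → A z = 0) (hg : Continuous g) :
    Integrable fun z => A z * g z := by
  obtain ⟨C, hC⟩ := (isCompact_closedBall (0 : ℂ × ℂ) 1).exists_bound_of_continuousOn hg.continuousOn
  refine (hA.norm.const_mul C).mono' (hA.aestronglyMeasurable.mul hg.aestronglyMeasurable)
    (Eventually.of_forall fun z => ?_)
  by_cases hz : z ∈ disc ×ˢ puncturedDisc
  · rw [norm_mul, mul_comm]
    refine mul_le_mul_of_nonneg_right (hC z ?_) (norm_nonneg _)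
    rw [mem_closedBall_zero_iff, Prod.norm_def, max_le_iff]
    exact ⟨le_of_lt hz.1, hz.2.2.le⟩
  · simp [hA0 z hz]

theorem dbar₁_conj_fst (z : ℂ × ℂ) : dbar₁ (fun w => conj w.1) z = 1 := by
  have h : HasFDerivAt (fun w : ℂ × ℂ => conj w.1)
      ((Complex.conjCLE : ℂ →L[ℝ] ℂ).comp (ContinuousLinearMap.fst ℝ ℂ ℂ)) z :=
    ((Complex.conjCLE : ℂ →L[ℝ] ℂ).comp (ContinuousLinearMap.fst ℝ ℂ ℂ)).hasFDerivAt
  rw [dbar₁, h.fderiv]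
  simp
  norm_num

theorem dbar₂_conj_snd (z : ℂ × ℂ) : dbar₂ (fun w => conj w.2) z = 1 := by
  have h : HasFDerivAt (fun w : ℂ × ℂ => conj w.2)
      ((Complex.conjCLE : ℂ →L[ℝ] ℂ).comp (ContinuousLinearMap.snd ℝ ℂ ℂ)) z :=
    ((Complex.conjCLE : ℂ →L[ℝ] ℂ).comp (ContinuousLinearMap.snd ℝ ℂ ℂ)).hasFDerivAt
  rw [dbar₂, h.fderiv]
  simp
  norm_num

theorem dbar₂_snd (z : ℂ × ℂ) : dbar₂ (fun w => w.2) z = 0 := by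
  rw [dbar₂, hasFDerivAt_snd.fderiv]
  simp

theorem setIntegral_eq_integral_mul_of_zero {A g : ℂ × ℂ → ℂ}
    (h : ∀ z, z ∉ disc ×ˢ puncturedDisc → g z = 0) :
    ∫ z in disc ×ˢ puncturedDisc, A z * g z = ∫ z, A z * g z :=
  setIntegral_eq_integral_of_forall_compl_eq_zero fun z hz => by rw [h z hz, mul_zero]

theorem setIntegral_hartogs_mul {g k : ℂ × ℂ → ℂ} (hg : LocallyIntegrableOn g hartogs volume)
    (hk : Continuous k) :
    ∫ z in hartogs, g z * k z = ∫ w in disc ×ˢ puncturedDisc,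
      (w.2 * conj w.2) * (g (phiInv w) * k (phiInv w)) :=
  setIntegral_hartogs (hg.aestronglyMeasurable.mul hk.aestronglyMeasurable)

theorem IsTest.eq_zero {U : Set (ℂ × ℂ)} {χ : ℂ × ℂ → ℂ} (hχ : IsTest U χ) {z : ℂ × ℂ}
    (hz : z ∉ U) : χ z = 0 :=
  image_eq_zero_of_notMem_tsupport fun h => hz (hχ.2.2 h)

theorem IsTest.dbar₁_eq_zero {U : Set (ℂ × ℂ)} {χ : ℂ × ℂ → ℂ} (hχ : IsTest U χ) {z : ℂ × ℂ}
    (hz : z ∉ U) : dbar₁ χ z = 0 := by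
  by_contra h
  exact hz (hχ.2.2 (support_dbar₁_subset χ h))

theorem IsTest.dbar₂_eq_zero {U : Set (ℂ × ℂ)} {χ : ℂ × ℂ → ℂ} (hχ : IsTest U χ) {z : ℂ × ℂ}
    (hz : z ∉ U) : dbar₂ χ z = 0 := by
  by_contra h
  exact hz (hχ.2.2 (support_dbar₂_subset χ h))

/-- The fundamental lemma of the calculus of variations. It is needed because `scrD` is an arbitrary
choice of representative. -/
theorem ae_eq_zero_of_isScrD {f : Form01} {g : ℂ × ℂ → ℂ}
    (h0 : IsScrD (disc ×ˢ puncturedDisc) f 0) (hg : IsScrD (disc ×ˢ puncturedDisc) f g) :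
    g =ᵐ[volume.restrict (disc ×ˢ puncturedDisc)] 0 := by
  have h := isOpen_disc_prod.ae_eq_zero_of_integral_contDiff_smul_eq_zero hg.2.1
    fun ψ hψ hc hsub => ?_
  · exact (ae_restrict_iff' isOpen_disc_prod.measurableSet).2 h
  have ht : IsTest (disc ×ˢ puncturedDisc) fun z => ((ψ z : ℝ) : ℂ) := by
    refine ⟨Complex.ofRealCLM.contDiff.comp hψ, hc.comp_left Complex.ofReal_zero, ?_⟩
    exact (closure_mono (Function.support_comp_subset Complex.ofReal_zero ψ)).trans hsub
  have h1 := (hg.2.2 _ ht).trans (h0.2.2 _ ht).symm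
  simp only [Pi.zero_apply, zero_mul, integral_zero] at h1
  rw [setIntegral_eq_integral_mul_of_zero fun z hz => ht.eq_zero hz] at h1
  rw [← h1]
  congr with z
  rw [Complex.real_smul, mul_comm]

/-! ### The transferred form, the reduction of `T`, and the weak equation. -/

section Transfer

variable {α : Form01} {a : ℂ × ℂ → ℂ}

theorem transfer_c₂_ae_eq_zero
    (hα : ∀ᵐ z ∂(volume.restrict hartogs), conj z.1 * α.c₁ z + conj z.2 * α.c₂ z = 0) :
    (transfer α).c₂ =ᵐ[volume.restrict (disc ×ˢ puncturedDisc)] 0 := by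
  have h := ae_weighted_iff.1 (measurePreserving_phiInv.quasiMeasurePreserving.ae hα)
  filter_upwards [h, ae_restrict_mem isOpen_disc_prod.measurableSet] with w hw hmem
  have h0 : conj w.2 ≠ 0 := by simpa using ne_zero_of_mem_puncturedDisc hmem.2
  refine (mul_eq_zero.1 (?_ : conj w.2 * _ = 0)).resolve_left h0
  simp only [phiInv, map_mul] at hw
  simp only [transfer, phiInv]
  linear_combination hw

theorem transfer_c₁_ae_eq
    (ha : a =ᵐ[volume.restrict (disc ×ˢ puncturedDisc)] α.c₁ ∘ phiInv) :
    (transfer α).c₁ =ᵐ[volume.restrict (disc ×ˢ puncturedDisc)] fun z => conj z.2 * a z := by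
  filter_upwards [ha] with w hw
  rw [hw]
  rfl

/-- Closedness is tested on `ψ = χ ∘ phi`. After the change of variables and the substitution `α̃₂ =
-w̄₁ α̃₁`, the derivatives of `ψ` combine to `w̄₁ ∂̄₁ψ + ∂̄₂ψ`, which is `∂̄₂χ` by the chain rule.
-/
theorem integral_mul_dbar₂_eq_zero (hclosed : α.WeaklyClosed hartogs)
    (hα : ∀ᵐ z ∂(volume.restrict hartogs), conj z.1 * α.c₁ z + conj z.2 * α.c₂ z = 0)
    (ha0 : ∀ z, z ∉ disc ×ˢ puncturedDisc → a z = 0)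
    (ha : a =ᵐ[volume.restrict (disc ×ˢ puncturedDisc)] α.c₁ ∘ phiInv)
    (hA : Integrable fun z => z.2 * conj z.2 * a z) {χ : ℂ × ℂ → ℂ}
    (hχ : IsTest (disc ×ˢ puncturedDisc) χ) :
    ∫ z, z.2 * conj z.2 * a z * dbar₂ χ z = 0 := by
  have hψ := hχ.comp_phi
  set ψ := χ ∘ phi with hψdef
  have hd1 := continuous_dbar₁ hψ.1
  have hd2 := continuous_dbar₂ hψ.1
  have h := hclosed.2 ψ hψ
  rw [setIntegral_hartogs_mul hclosed.1.2 hd1, setIntegral_hartogs_mul hclosed.1.1 hd2] at h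
  have hA0 : ∀ z, z ∉ disc ×ˢ puncturedDisc → z.2 * conj z.2 * a z = 0 := fun z hz => by
    rw [ha0 z hz, mul_zero]
  have hcont : Continuous phiInv := (contDiff_phiInv (n := 0)).continuous
  have hi1 : Integrable fun w : ℂ × ℂ =>
      w.2 * conj w.2 * a w * (-(conj w.1 * dbar₁ ψ (phiInv w))) :=
    integrable_mul_of_continuous hA hA0 (by
      have := Complex.continuous_conj
      have := hd1.comp hcont
      fun_prop)
  have hi2 : Integrable fun w => w.2 * conj w.2 * a w * dbar₂ ψ (phiInv w) :=
    integrable_mul_of_continuous hA hA0 (hd2.comp hcont)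
  have e1 : ∫ w in disc ×ˢ puncturedDisc, w.2 * conj w.2 * (α.c₂ (phiInv w) * dbar₁ ψ (phiInv w)) =
      ∫ w in disc ×ˢ puncturedDisc,
        w.2 * conj w.2 * a w * (-(conj w.1 * dbar₁ ψ (phiInv w))) := by
    refine integral_congr_ae ?_
    filter_upwards [ha, transfer_c₂_ae_eq_zero hα] with w h1 h2
    rw [h1]
    simp only [transfer, Pi.zero_apply] at h2
    simp only [Function.comp_apply]
    linear_combination (w.2 * conj w.2 * dbar₁ ψ (phiInv w)) * h2
  have e2 : ∫ w in disc ×ˢ puncturedDisc, w.2 * conj w.2 * (α.c₁ (phiInv w) * dbar₂ ψ (phiInv w)) =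
      ∫ w in disc ×ˢ puncturedDisc, w.2 * conj w.2 * a w * dbar₂ ψ (phiInv w) := by
    refine integral_congr_ae ?_
    filter_upwards [ha] with w h1
    rw [h1]
    simp only [Function.comp_apply]
    ring
  rw [e1, e2] at h
  rw [← setIntegral_eq_integral_mul_of_zero fun z hz => hχ.dbar₂_eq_zero hz]
  rw [← sub_eq_zero, ← integral_sub hi1.integrableOn hi2.integrableOn] at h
  rw [← neg_eq_zero, ← integral_neg, ← h]
  refine setIntegral_congr_fun isOpen_disc_prod.measurableSet fun w hw => ?_
  have hw0 := ne_zero_of_mem_puncturedDisc hw.2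
  have hev : χ =ᶠ[𝓝 w] ψ ∘ phiInv := by
    filter_upwards [isOpen_disc_prod.mem_nhds hw] with x hx
    simp only [hψdef, Function.comp_apply, phi_phiInv (ne_zero_of_mem_puncturedDisc hx.2)]
  have hd : dbar₂ χ w = dbar₂ (ψ ∘ phiInv) w := by
    simp only [dbar₂, hev.fderiv_eq]
  rw [hd, dbar₂_comp_phiInv (hψ.1.differentiable (by simp) _)]
  ring

/-- Passing from the integrable `|w₂|² a` to `w̄₂ a` means dividing by `w₂`, which is bounded away
from zero on compact subsets. -/
theorem transfer_locInt
    (hα : ∀ᵐ z ∂(volume.restrict hartogs), conj z.1 * α.c₁ z + conj z.2 * α.c₂ z = 0)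
    (ha : a =ᵐ[volume.restrict (disc ×ˢ puncturedDisc)] α.c₁ ∘ phiInv)
    (hA : Integrable fun z => z.2 * conj z.2 * a z) :
    (transfer α).LocInt (disc ×ˢ puncturedDisc) := by
  refine ⟨?_, locallyIntegrableOn_zero.congr (transfer_c₂_ae_eq_zero hα).symm⟩
  refine LocallyIntegrableOn.congr (transfer_c₁_ae_eq ha).symm ?_
  refine (locallyIntegrableOn_iff isOpen_disc_prod.isLocallyClosed).2 fun K hK hKc => ?_
  have h := IntegrableOn.continuousOn_mul (g := fun z : ℂ × ℂ => z.2⁻¹)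
    (continuousOn_snd.inv₀ fun z hz => ne_zero_of_mem_puncturedDisc (hK hz).2)
    (hA.integrableOn (s := K)) hKc
  refine h.congr_fun (fun z hz => ?_) hKc.measurableSet
  have := ne_zero_of_mem_puncturedDisc (hK hz).2
  beta_reduce
  field_simp

/-- Since `∂̄₂ w₂ = 0`, testing `f₁` on `ψ` amounts to testing `w₂ f₁` on `w₂⁻¹ ψ`, again a test
function. -/
theorem isScrD_transfer_zero (hclosed : α.WeaklyClosed hartogs)
    (hα : ∀ᵐ z ∂(volume.restrict hartogs), conj z.1 * α.c₁ z + conj z.2 * α.c₂ z = 0)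
    (ha0 : ∀ z, z ∉ disc ×ˢ puncturedDisc → a z = 0)
    (ha : a =ᵐ[volume.restrict (disc ×ˢ puncturedDisc)] α.c₁ ∘ phiInv)
    (hA : Integrable fun z => z.2 * conj z.2 * a z) :
    IsScrD (disc ×ˢ puncturedDisc) (transfer α) 0 := by
  refine ⟨transfer_locInt hα ha hA, locallyIntegrableOn_zero, fun ψ hψ => ?_⟩
  have h2 : ∫ z in disc ×ˢ puncturedDisc, (transfer α).c₂ z * dbar₁ ψ z = 0 := by
    refine integral_eq_zero_of_ae ?_
    filter_upwards [transfer_c₂_ae_eq_zero hα] with z hz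
    simp [hz]
  have hψ' := hψ.inv_snd_mul
  have h1 : ∫ z in disc ×ˢ puncturedDisc, (transfer α).c₁ z * dbar₂ ψ z = 0 := by
    rw [← integral_mul_dbar₂_eq_zero hclosed hα ha0 ha hA hψ',
      ← setIntegral_eq_integral_mul_of_zero fun z hz => hψ'.dbar₂_eq_zero hz]
    refine integral_congr_ae ?_
    filter_upwards [transfer_c₁_ae_eq ha] with z hz
    have he : ψ = fun w => w.2 * (w.2⁻¹ * ψ w) := by
      ext w
      by_cases hw : w.2 = 0
      · have : ψ w = 0 := hψ.eq_zero fun hm => ne_zero_of_mem_puncturedDisc hm.2 hw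
        simp [this]
      · field_simp
    have hd : dbar₂ ψ z = z.2 * dbar₂ (fun w => w.2⁻¹ * ψ w) z := by
      conv_lhs => rw [he]
      rw [dbar₂_mul differentiableAt_snd (hψ'.1.differentiable (by simp) z), dbar₂_snd]
      ring
    rw [hz, hd]
    ring
  simp [h1, h2]

theorem scrD_transfer_ae_eq_zero (h0 : IsScrD (disc ×ˢ puncturedDisc) (transfer α) 0) :
    IsScrD (disc ×ˢ puncturedDisc) (transfer α) (scrD (disc ×ˢ puncturedDisc) (transfer α)) ∧
    scrD (disc ×ˢ puncturedDisc) (transfer α) =ᵐ[volume.restrict (disc ×ˢ puncturedDisc)] 0 := by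
  have hex : ∃ g, IsScrD (disc ×ˢ puncturedDisc) (transfer α) g := ⟨0, h0⟩
  have h : IsScrD (disc ×ˢ puncturedDisc) (transfer α)
      (scrD (disc ×ˢ puncturedDisc) (transfer α)) := by
    rw [scrD, dif_pos hex]
    exact hex.choose_spec
  exact ⟨h, ae_eq_zero_of_isScrD h0 h⟩

theorem ae_ae_fst {P : ℂ × ℂ → Prop} (h : ∀ᵐ z ∂(volume.restrict (disc ×ˢ puncturedDisc)), P z) :
    ∀ᵐ z ∂(volume.restrict (disc ×ˢ puncturedDisc)),
      ∀ᵐ ζ ∂(volume.restrict puncturedDisc), P (z.1, ζ) := by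
  rw [Measure.volume_eq_prod, ← Measure.prod_restrict] at h ⊢
  exact Measure.quasiMeasurePreserving_fst.ae (Measure.ae_ae_of_ae_prod h)

theorem ae_ae_snd {P : ℂ × ℂ → Prop} (h : ∀ᵐ z ∂(volume.restrict (disc ×ˢ puncturedDisc)), P z) :
    ∀ᵐ z ∂(volume.restrict (disc ×ˢ puncturedDisc)),
      ∀ᵐ ζ ∂(volume.restrict disc), P (ζ, z.2) := by
  rw [Measure.volume_eq_prod, ← Measure.prod_restrict] at h ⊢
  have h' := (Measure.measurePreserving_swap (μ := volume.restrict puncturedDisc)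
    (ν := volume.restrict disc)).quasiMeasurePreserving.ae h
  exact Measure.quasiMeasurePreserving_snd.ae (Measure.ae_ae_of_ae_prod h')

/-- Fubini for the kernel bound with the indicator of the product domain in place of a test
function; the extra `w₂` is then divided out at a fixed nonzero value. -/
theorem ae_integrableOn_cauchy (ha0 : ∀ z, z ∉ disc ×ˢ puncturedDisc → a z = 0)
    (hA : Integrable fun z => z.2 * conj z.2 * a z) :
    ∀ᵐ w ∂(volume.restrict (disc ×ˢ puncturedDisc)),
      Integrable fun ζ => conj w.2 * a (ζ, w.2) / (ζ - w.1) := by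
  have hA0 : ∀ z : ℂ × ℂ, 1 ≤ ‖z.1‖ → z.2 * conj z.2 * a z = 0 := fun z hz => by
    rw [ha0 z fun h => not_lt.2 hz h.1, mul_zero]
  have hm : Measurable ((disc ×ˢ puncturedDisc).indicator fun _ : ℂ × ℂ => (1 : ℂ)) :=
    measurable_const.indicator isOpen_disc_prod.measurableSet
  have h := integrable_mul_kernel' (B := 1) (R := 1) hA hA0 hm
    (fun z => by
      refine (norm_indicator_le_norm_self _ _).trans ?_
      simp)
    (fun z hz => indicator_of_notMem (fun h => not_lt.2 hz h.1) _)
  filter_upwards [ae_restrict_of_ae h.prod_right_ae, ae_restrict_mem isOpen_disc_prod.measurableSet]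
    with w hw hmem
  have hpi : (Real.pi : ℂ) ≠ 0 := by exact_mod_cast Real.pi_ne_zero
  have h0 := ne_zero_of_mem_puncturedDisc hmem.2
  refine (hw.const_mul (-(Real.pi : ℂ) * w.2⁻¹)).congr (Eventually.of_forall fun ζ => ?_)
  beta_reduce
  rw [indicator_of_mem hmem, ← neg_sub ζ w.1, mul_neg, inv_neg, mul_inv]
  field_simp

theorem opT_transfer_ae_eq
    (hα : ∀ᵐ z ∂(volume.restrict hartogs), conj z.1 * α.c₁ z + conj z.2 * α.c₂ z = 0)
    (ha0 : ∀ z, z ∉ disc ×ˢ puncturedDisc → a z = 0)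
    (ha : a =ᵐ[volume.restrict (disc ×ˢ puncturedDisc)] α.c₁ ∘ phiInv)
    (hs : scrD (disc ×ˢ puncturedDisc) (transfer α)
      =ᵐ[volume.restrict (disc ×ˢ puncturedDisc)] 0) :
    opT disc puncturedDisc (transfer α) =ᵐ[volume.restrict (disc ×ˢ puncturedDisc)]
      cauchyT fun z => conj z.2 * a z := by
  filter_upwards [ae_ae_fst (transfer_c₂_ae_eq_zero hα), ae_ae_snd (transfer_c₁_ae_eq ha)]
    with w h2 h1
  have e2 : ∫ ζ in puncturedDisc, (transfer α).c₂ (w.1, ζ) / (ζ - w.2) = 0 := by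
    refine integral_eq_zero_of_ae ?_
    filter_upwards [h2] with ζ hζ
    simp [hζ]
  have e3 : ∫ ζ in disc ×ˢ puncturedDisc, scrD (disc ×ˢ puncturedDisc) (transfer α) ζ /
      ((ζ.1 - w.1) * (ζ.2 - w.2)) = 0 := by
    refine integral_eq_zero_of_ae ?_
    filter_upwards [hs] with ζ hζ
    simp [hζ]
  have e1 : ∫ ζ in disc, (transfer α).c₁ (ζ, w.2) / (ζ - w.1) =
      ∫ ζ, conj w.2 * a (ζ, w.2) / (ζ - w.1) := by
    rw [integral_congr_ae (g := fun ζ => conj w.2 * a (ζ, w.2) / (ζ - w.1)) (by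
      filter_upwards [h1] with ζ hζ
      rw [hζ])]
    refine setIntegral_eq_integral_of_forall_compl_eq_zero fun ζ hζ => ?_
    rw [ha0 (ζ, w.2) fun h => hζ h.1, mul_zero, zero_div]
  simp only [opT, cIntegral, cIntegral₂, e1, e2, e3, mul_zero, zero_add, add_zero]
  rw [cauchyT, ← integral_const_mul, ← integral_const_mul]
  congr with ζ
  have hpi : (Real.pi : ℂ) ≠ 0 := by exact_mod_cast Real.pi_ne_zero
  rw [← neg_sub ζ w.1, mul_neg, inv_neg, mul_inv, div_eq_mul_inv _ (ζ - w.1)]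
  field_simp [Complex.I_ne_zero]

theorem opTWellDefined_transfer
    (hα : ∀ᵐ z ∂(volume.restrict hartogs), conj z.1 * α.c₁ z + conj z.2 * α.c₂ z = 0)
    (ha0 : ∀ z, z ∉ disc ×ˢ puncturedDisc → a z = 0)
    (ha : a =ᵐ[volume.restrict (disc ×ˢ puncturedDisc)] α.c₁ ∘ phiInv)
    (hA : Integrable fun z => z.2 * conj z.2 * a z)
    (h0 : IsScrD (disc ×ˢ puncturedDisc) (transfer α) 0) :
    OpTWellDefined disc puncturedDisc (transfer α) := by
  obtain ⟨hs, hs0⟩ := scrD_transfer_ae_eq_zero h0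
  refine ⟨hs, ?_⟩
  filter_upwards [ae_ae_fst (transfer_c₂_ae_eq_zero hα), ae_ae_snd (transfer_c₁_ae_eq ha),
    ae_integrableOn_cauchy ha0 hA] with w h2 h1 h3
  refine ⟨?_, ?_, ?_⟩
  · refine (integrable_zero _ _ _).congr ?_
    filter_upwards [h2] with ζ hζ
    simp [hζ]
  · refine h3.integrableOn.congr ?_
    filter_upwards [h1] with ζ hζ
    rw [hζ]
  · refine (integrable_zero _ _ _).congr ?_
    filter_upwards [hs0] with ζ hζ
    simp [hζ]

theorem cauchyT_snd_mul (F : ℂ × ℂ → ℂ) (w : ℂ × ℂ) :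
    cauchyT (fun z => z.2 * F z) w = w.2 * cauchyT F w := by
  simp only [cauchyT, mul_assoc]
  exact integral_const_mul _ _

theorem isWeakSolution_cauchyT_comp_phi (hclosed : α.WeaklyClosed hartogs)
    (hα : ∀ᵐ z ∂(volume.restrict hartogs), conj z.1 * α.c₁ z + conj z.2 * α.c₂ z = 0)
    (ha0 : ∀ z, z ∉ disc ×ˢ puncturedDisc → a z = 0)
    (ha : a =ᵐ[volume.restrict (disc ×ˢ puncturedDisc)] α.c₁ ∘ phiInv)
    (hA : Integrable fun z => z.2 * conj z.2 * a z)
    {v : ℂ × ℂ → ℂ} (hv : v =ᵐ[volume.restrict hartogs] (cauchyT fun z => conj z.2 * a z) ∘ phi)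
    (hvi : LocallyIntegrableOn v hartogs volume) :
    IsWeakSolution hartogs v α := by
  refine ⟨hvi, hclosed.1, fun ψ hψ => ?_⟩
  -- The Jacobian `|w₂|² = w₂ w̄₂` is split: `w₂` makes the Cauchy transform that of the integrable
  -- `A`, and `w̄₂` is absorbed by the chain rule.
  set A : ℂ × ℂ → ℂ := fun z => z.2 * conj z.2 * a z with hAdef
  have hA0' : ∀ z, z ∉ disc ×ˢ puncturedDisc → A z = 0 := fun z hz => by
    simp only [hAdef, ha0 z hz, mul_zero]
  have hA0 : ∀ z : ℂ × ℂ, 1 ≤ ‖z.1‖ → A z = 0 := fun z hz => hA0' z fun h => not_lt.2 hz h.1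
  have hUA : ∀ w, cauchyT A w = w.2 * cauchyT (fun z => conj z.2 * a z) w := fun w => by
    rw [← cauchyT_snd_mul]
    simp only [hAdef, mul_assoc]
  have hcl := fun χ hχ => integral_mul_dbar₂_eq_zero (χ := χ) hclosed hα ha0 ha hA hχ
  have hχ := hψ.comp_phiInv
  set χ := ψ ∘ phiInv with hχdef
  have hvw : ∀ᵐ w ∂(volume.restrict (disc ×ˢ puncturedDisc)),
      v (phiInv w) = cauchyT (fun z => conj z.2 * a z) w := by
    filter_upwards [ae_weighted_iff.1 (measurePreserving_phiInv.quasiMeasurePreserving.ae hv),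
      ae_restrict_mem isOpen_disc_prod.measurableSet] with w hw hmem
    rw [hw, Function.comp_apply, phi_phiInv (ne_zero_of_mem_puncturedDisc hmem.2)]
  have hdiff : ∀ w, DifferentiableAt ℝ ψ (phiInv w) := fun w => hψ.1.differentiable (by simp) _
  constructor
  · rw [setIntegral_hartogs_mul hvi (continuous_dbar₁ hψ.1),
      setIntegral_hartogs_mul hclosed.1.1 hψ.1.continuous]
    trans ∫ w in disc ×ˢ puncturedDisc, cauchyT A w * dbar₁ χ w
    · refine integral_congr_ae ?_
      filter_upwards [hvw] with w hw
      rw [hw, hUA, dbar₁_comp_phiInv (hdiff w)]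
      ring
    rw [setIntegral_eq_integral_mul_of_zero fun z hz => hχ.dbar₁_eq_zero hz,
      integral_cauchyT_dbar₁ hA hA0 hχ.1 hχ.2.1,
      ← setIntegral_eq_integral_mul_of_zero fun z hz => hχ.eq_zero hz]
    congr 1
    refine integral_congr_ae ?_
    filter_upwards [ha] with w hw
    simp only [hAdef, hw, hχdef, Function.comp_apply]
    ring
  · rw [setIntegral_hartogs_mul hvi (continuous_dbar₂ hψ.1),
      setIntegral_hartogs_mul hclosed.1.2 hψ.1.continuous]
    have hc1 : ContDiff ℝ ((⊤ : ℕ∞) : WithTop ℕ∞) fun z : ℂ × ℂ => conj z.1 :=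
      Complex.conjCLE.contDiff.comp contDiff_fst
    have hc2 : ContDiff ℝ ((⊤ : ℕ∞) : WithTop ℕ∞) fun z : ℂ × ℂ => conj z.2 :=
      Complex.conjCLE.contDiff.comp contDiff_snd
    have ht1 := hχ.mul_left hc1
    have ht2 := hχ.mul_left hc2
    have hi1 : Integrable fun w => cauchyT A w * dbar₁ (fun z => conj z.1 * χ z) w := by
      obtain ⟨B, R, hB, hR⟩ := exists_bound_of_hasCompactSupport (continuous_dbar₁ ht1.1)
        (hasCompactSupport_dbar₁ ht1.2.1)
      exact integrable_cauchyT_mul hA hA0 (continuous_dbar₁ ht1.1).measurable hB hR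
    have hi2 : Integrable fun w => cauchyT A w * dbar₂ (fun z => conj z.2 * χ z) w := by
      obtain ⟨B, R, hB, hR⟩ := exists_bound_of_hasCompactSupport (continuous_dbar₂ ht2.1)
        (hasCompactSupport_dbar₂ ht2.2.1)
      exact integrable_cauchyT_mul hA hA0 (continuous_dbar₂ ht2.1).measurable hB hR
    -- By the chain rule `w̄₂ (∂̄₂ψ ∘ φ⁻¹) = w̄₂ ∂̄₂χ - w̄₁ ∂̄₁χ`. Moving `w̄₂` and `w̄₁` inside the
    -- derivatives adds `χ - χ = 0`.
    trans ∫ w in disc ×ˢ puncturedDisc, (cauchyT A w * dbar₂ (fun z => conj z.2 * χ z) w -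
      cauchyT A w * dbar₁ (fun z => conj z.1 * χ z) w)
    · refine integral_congr_ae ?_
      filter_upwards [hvw] with w hw
      have hχd : DifferentiableAt ℝ χ w := hχ.1.differentiable (by simp) w
      rw [hw, hUA, dbar₁_mul (hc1.differentiable (by simp) w) hχd,
        dbar₂_mul (hc2.differentiable (by simp) w) hχd, dbar₁_conj_fst, dbar₂_conj_snd,
        dbar₁_comp_phiInv (hdiff w), dbar₂_comp_phiInv (hdiff w)]
      ring
    rw [integral_sub hi2.integrableOn hi1.integrableOn,
      setIntegral_eq_integral_mul_of_zero fun z hz => ht1.dbar₁_eq_zero hz,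
      setIntegral_eq_integral_mul_of_zero fun z hz => ht2.dbar₂_eq_zero hz,
      integral_cauchyT_dbar₂ hA hA0 hcl ht2, integral_cauchyT_dbar₁ hA hA0 ht1.1 ht1.2.1,
      ← setIntegral_eq_integral_mul_of_zero fun z hz => ht1.eq_zero hz, zero_sub, neg_neg,
      ← integral_neg]
    refine integral_congr_ae ?_
    filter_upwards [ha, transfer_c₂_ae_eq_zero hα] with w hw h2
    simp only [transfer, Pi.zero_apply] at h2
    simp only [hAdef, hw, hχdef, Function.comp_apply]
    linear_combination (w.2 * conj w.2 * ψ (phiInv w)) * h2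

end Transfer

end

end HartogsDbar

/-! ### Assembly of the theorem. -/

theorem theorem5p2 (p : ℝ≥0∞) (hp : 1 ≤ p) (hp' : p ≠ ∞) :
    ∃ C : ℝ≥0, 0 < C ∧ ∀ α : HartogsDbar.Form01,
      α.WeaklyClosed HartogsDbar.hartogs →
      (∀ᵐ z ∂(volume.restrict HartogsDbar.hartogs),
        conj z.1 * α.c₁ z + conj z.2 * α.c₂ z = 0) →
      MemLp α.c₁ p (volume.restrict HartogsDbar.hartogs) →
      HartogsDbar.OpTWellDefined HartogsDbar.disc HartogsDbar.puncturedDisc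
          (HartogsDbar.transfer α) ∧
      HartogsDbar.IsWeakSolution HartogsDbar.hartogs
        (HartogsDbar.opT HartogsDbar.disc HartogsDbar.puncturedDisc
          (HartogsDbar.transfer α) ∘ HartogsDbar.phi) α ∧
      MemLp (HartogsDbar.opT HartogsDbar.disc HartogsDbar.puncturedDisc
          (HartogsDbar.transfer α) ∘ HartogsDbar.phi) p
        (volume.restrict HartogsDbar.hartogs) ∧
      eLpNorm (HartogsDbar.opT HartogsDbar.disc HartogsDbar.puncturedDisc
          (HartogsDbar.transfer α) ∘ HartogsDbar.phi) p
          (volume.restrict HartogsDbar.hartogs) ≤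
        C * eLpNorm α.c₁ p (volume.restrict HartogsDbar.hartogs) := by

  have hK := (HartogsDbar.kernelMass_lt_top 2).ne
  -- `kernelMass 2` already bounds the operator; adding one makes positivity immediate.
  refine ⟨(HartogsDbar.kernelMass 2).toNNReal + 1, by positivity, fun α hclosed hα hmem => ?_⟩
  have hmem' : MemLp (α.c₁ ∘ HartogsDbar.phiInv) p HartogsDbar.weighted :=
    hmem.comp_measurePreserving HartogsDbar.measurePreserving_phiInv
  obtain ⟨a, ham, ha0, ha⟩ :=
    HartogsDbar.exists_measurable_representative hmem'.aestronglyMeasurable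
  have haw : a =ᵐ[HartogsDbar.weighted] α.c₁ ∘ HartogsDbar.phiInv :=
    HartogsDbar.ae_weighted_iff.2 ha
  have hap : MemLp a p HartogsDbar.weighted := (memLp_congr_ae haw).2 hmem'
  -- The weighted measure is finite, so `L^p` lies in `L¹` for `p ≥ 1`; the density supplies the
  -- factor `|w₂|²`.
  have hA : Integrable fun z : ℂ × ℂ => z.2 * conj z.2 * a z := by
    refine (integrableOn_iff_integrable_of_support_subset fun z hz => ?_).1
      (HartogsDbar.integrable_weighted_iff.1 (hap.integrable hp))
    by_contra h
    exact hz (by simp [ha0 z h])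
  have h0 := HartogsDbar.isScrD_transfer_zero hclosed hα ha0 ha hA
  have hT := HartogsDbar.opT_transfer_ae_eq hα ha0 ha
    (HartogsDbar.scrD_transfer_ae_eq_zero h0).2
  have hv := HartogsDbar.measurePreserving_phi.quasiMeasurePreserving.ae_eq
    (HartogsDbar.ae_weighted_iff.2 hT)
  have hsm : StronglyMeasurable (HartogsDbar.cauchyT fun z => conj z.2 * a z) :=
    HartogsDbar.stronglyMeasurable_cauchyT
      ((Complex.continuous_conj.measurable.comp measurable_snd).mul ham)
  have hle := HartogsDbar.eLpNorm_cauchyT_le ham ha0 hp hp'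
  have hcM : MemLp (HartogsDbar.cauchyT fun z => conj z.2 * a z) p HartogsDbar.weighted :=
    ⟨hsm.aestronglyMeasurable, hle.trans_lt (ENNReal.mul_lt_top hK.lt_top hap.2)⟩
  have hvM := (memLp_congr_ae hv).2
    (hcM.comp_measurePreserving HartogsDbar.measurePreserving_phi)
  refine ⟨HartogsDbar.opTWellDefined_transfer hα ha0 ha hA h0, ?_, hvM, ?_⟩
  · exact HartogsDbar.isWeakSolution_cauchyT_comp_phi hclosed hα ha0 ha hA hv
      (IntegrableOn.locallyIntegrableOn (hvM.integrable hp))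
  · rw [eLpNorm_congr_ae hv, eLpNorm_comp_measurePreserving hsm.aestronglyMeasurable
      HartogsDbar.measurePreserving_phi,
      ← eLpNorm_comp_measurePreserving hmem.1 HartogsDbar.measurePreserving_phiInv,
      ← eLpNorm_congr_ae haw]
    refine hle.trans (mul_le_mul_left ?_ _)
    rw [ENNReal.coe_add, ENNReal.coe_toNNReal hK]
    exact le_self_add
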